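/- Let $G$ be a finite connected directed graph without loop edges (multiple edges are allowed), each edge being parametrized by $[0,1]$ from its initial to its terminal vertex. Let $f:G\to G$ be a continuous map that permutes the vertices and is homotopic to the identity. Let $L_f$ be its linearization: the map homotopic to $f$ relative to the vertices that maps every edge linearly onto a contracted (nowhere backtracking) edge path. Let $p:\widetilde G\to G$ be the universal covering, $\pi$ its group of covering transformations, $\widetilde f$ a lift of $f$ that commutes with every element of $\pi$, and $\widetilde L_f$ the lift of $L_f$ obtained by lifting a homotopy from $f$ to $L_f$ relative to the vertices, starting at $\widetilde f$. Let $E$ be an edge of $G$ and $\widetilde E$ a chosen lift of $E$ to $\widetilde G$. For $z$ the initial vertex of $E$ or a point in the interior of $E$, let $\widetilde z$ be the corresponding point of $\widetilde E$. If $g\in\{f,L_f\}$, $k\ge 1$, $g^k(z)=z$ and $\widetilde g^k(\widetilde z)=w\widetilde z$ with $w\in\pi$, then the rotation element of $z$ is $\rho_{\widetilde g}(z)=w^{1/k}$. Here the $w^{1/k}$ are formal roots, modulo the equivalence relation generated by $w^{1/k}=(w^j)^{1/(jk)}$ for $j\ge1$. Let $m,n\ge 1$. Let $x\in\mathrm{Fix}(f^m)$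 be the initial vertex of $E$, and let $y\in \mathrm{Fix}(L_f^n)$ be a point in the interior of $E$. Write $\widetilde f^m(\widetilde x)=\alpha\widetilde x$ and $\widetilde L_f^n(\widetilde y)=\beta\widetilde y$ with $\alpha,\beta\in\pi$, so that $\rho_{\widetilde f}(x)=\alpha^{1/m}$ and $\rho_{\widetilde L_f}(y)=\beta^{1/n}$. Assume that the path $L_f^m(E)$ begins with $E$. Let $\mathcal S(\alpha^{1/m},\beta^{1/n})$ be the set of all $v^{1/(rm+sn)}$, where $v=v_1\cdots v_l$ with $l\ge1$ and $v_i\in\{\alpha,\beta\}$ is a product with $r$ factors $\alpha$ and $s$ factors $\beta$. Then: (1) Every $q\in\mathcal S(\alpha^{1/m},\beta^{1/n})$ is the rotation element $\rho_{\widetilde f}(z)$ of a periodic point $z$ of $f$ that lies in the interior of $E$ or is the vertex $x$. In particular, if $q\ne\rho_{\widetilde f}(x)$, then there is such a $z$ in the interior of $E$. (2) If $L_f^n$ is not the identity on $E$, then every $q\in\mathcal S(\alpha^{1/m},\beta^{1/n})$ that is built with $s\ge 1$ is the rotation element $\rho_{\widetilde f}(z)$ of a periodic point $z$ of $f$ in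 the interior of $E$. -/

import Mathlib

open unitInterval

/-- A directed graph with vertex set `V` and edge set `E`; multiple edges are allowed. -/
structure MultiDigraph (V E : Type*) where
  src : E → V
  tgt : E → V

namespace MultiDigraph

variable {V E : Type*} (G : MultiDigraph V E)

/-- The gluing relation: the ends of the copy `{e} × [0,1]` are attached to the
initial and to the terminal vertex of the edge `e`. -/
inductive Glue : V ⊕ (E × I) → V ⊕ (E × I) → Prop
  | src (e : E) : Glue (Sum.inr (e, 0)) (Sum.inl (G.src e))
  | tgt (e : E) : Glue (Sum.inr (e, 1)) (Sum.inl (G.tgt e))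

/-- The graph as a topological space: `V ⊔ (E × [0,1])` modulo the gluing relation. -/
def Space : Type _ := Quot G.Glue

/-- The quotient topology, with `V` and `E` discrete. -/
instance : TopologicalSpace G.Space :=
  letI : TopologicalSpace V := ⊥
  letI : TopologicalSpace E := ⊥
  inferInstanceAs (TopologicalSpace (Quot G.Glue))

/-- The point of the space given by a vertex. -/
def vertex (v : V) : G.Space := Quot.mk _ (Sum.inl v)

/-- The set of all vertices, as points of the space. -/
def vertices : Set G.Space := Set.range G.vertex

/-- The edge `e`, parametrized by `[0,1]` from its initial to its terminal vertex. -/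
def edge (e : E) : C(I, G.Space) where
  toFun t := Quot.mk _ (Sum.inr (e, t))
  continuous_toFun := by
    let _ : TopologicalSpace V := ⊥
    let _ : TopologicalSpace E := ⊥
    exact continuous_quot_mk.comp (continuous_inr.comp (by fun_prop))

theorem edge_zero (e : E) : G.edge e 0 = G.vertex (G.src e) := Quot.sound (Glue.src e)

theorem edge_one (e : E) : G.edge e 1 = G.vertex (G.tgt e) := Quot.sound (Glue.tgt e)

/-- An edge traversed forwards (`true`) or backwards (`false`). -/
def orientedEdge (a : E × Bool) (t : I) : G.Space :=
  if a.2 then G.edge a.1 t else G.edge a.1 (σ t)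

/-- `L` maps the edge `e` linearly onto a contracted (i.e. nowhere backtracking) path
consisting of `k ≥ 1` edges: the `i`-th subinterval of length `1/k` is mapped linearly
onto the `i`-th edge of the path. -/
def IsLinearOn (L : G.Space → G.Space) (e : E) : Prop :=
  ∃ (k : ℕ) (c : Fin k → E × Bool), 0 < k ∧
    (∀ i j : Fin k, (j : ℕ) = i + 1 → c j ≠ ((c i).1, !(c i).2)) ∧
    ∀ (i : Fin k) (s t : I), (k : ℝ) * (s : ℝ) = (i : ℕ) + (t : ℝ) →
      L (G.edge e s) = G.orientedEdge (c i) t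

/-- `f` is a vertex map: it permutes the vertices. -/
def IsVertexMap (f : C(G.Space, G.Space)) : Prop :=
  Set.BijOn f G.vertices G.vertices

/-- `L` is the linearization of `f`: it is homotopic to `f` relative to the vertices
and linear on every edge. -/
def IsLinearization (f L : C(G.Space, G.Space)) : Prop :=
  f.HomotopicRel L G.vertices ∧ ∀ e : E, G.IsLinearOn L e

/-- The path `γ` begins with the edge `e`: an initial segment `[0,a]` of `γ` runs once
through `e`, from its initial to its terminal vertex. -/
def BeginsWith (γ : I → G.Space) (e : E) : Prop :=
  ∃ (a : I) (φ : I → I), 0 < a ∧ φ 0 = 0 ∧ φ a = 1 ∧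
    ContinuousOn φ (Set.Icc 0 a) ∧ StrictMonoOn φ (Set.Icc 0 a) ∧
    ∀ t ∈ Set.Icc 0 a, γ t = G.edge e (φ t)

/-- `Lt` is the lift of the linearization `L` determined by the lift `ft` of `f`: a homotopy
from `f` to `L` relative to the vertices is lifted, starting at `ft`, and ends at `Lt`. -/
def IsInducedLift {X : Type*} [TopologicalSpace X] (p : X → G.Space)
    (f L : C(G.Space, G.Space)) (ft Lt : C(X, X)) : Prop :=
  ∃ (h : f.HomotopyRel L G.vertices) (H : ft.Homotopy Lt),
    ∀ (s : I) (u : X), p (H (s, u)) = h (s, p u)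

end MultiDigraph

/-- The group of covering transformations of `p`. -/
def deckGroup {X B : Type*} [TopologicalSpace X] (p : X → B) : Subgroup (X ≃ₜ X) where
  carrier := {g | ∀ u, p (g u) = p u}
  mul_mem' := by
    intro a b ha hb u
    exact (ha (b u)).trans (hb u)
  one_mem' := fun _ => rfl
  inv_mem' := by
    intro a ha u
    have h := ha (a⁻¹ u)
    have h2 : a (a⁻¹ u) = u := a.apply_symm_apply u
    rw [h2] at h
    exact h.symm

/-- Formal roots `w^(1/n)` of elements of a group: pairs `(w, n)` modulo the equivalence
relation generated by `w^(1/n) = (w^j)^(1/(jn))`. -/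
def FormalRoot (Γ : Type*) [Group Γ] : Type _ :=
  Quot (fun a b : Γ × ℕ+ => ∃ j : ℕ+, b = (a.1 ^ (j : ℕ), j * a.2))

/-- The formal root `w^(1/n)`. -/
def formalRoot {Γ : Type*} [Group Γ] (w : Γ) (n : ℕ+) : FormalRoot Γ :=
  Quot.mk _ (w, n)

/-- `q` is the formal root `v^(1/(rm+sn))`, where `v` is the product of the word `l` in the
letters `α` (`true`) and `β` (`false`), with `r` occurrences of `α` and `s` of `β`. -/
def IsWordRoot {Γ : Type*} [Group Γ] (α : Γ) (m : ℕ+) (β : Γ) (n : ℕ+) (l : List Bool)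
    (q : FormalRoot Γ) : Prop :=
  ∃ k : ℕ+, (k : ℕ) = l.count true * m + l.count false * n ∧
    q = formalRoot (l.map (fun b => if b then α else β)).prod k

/-- The set `S(α^(1/m), β^(1/n))` of all `v^(1/(rm+sn))`, where `v` is a nonempty product of
`r` factors `α` and `s` factors `β`, in any order. -/
def rootSet {Γ : Type*} [Group Γ] (α : Γ) (m : ℕ+) (β : Γ) (n : ℕ+) : Set (FormalRoot Γ) :=
  {q | ∃ l : List Bool, l ≠ [] ∧ IsWordRoot α m β n l q}

/-- The elements of `S(α^(1/m), β^(1/n))` that are built with at least one factor `β`. -/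
def rootSetPos {Γ : Type*} [Group Γ] (α : Γ) (m : ℕ+) (β : Γ) (n : ℕ+) :
    Set (FormalRoot Γ) :=
  {q | ∃ l : List Bool, false ∈ l ∧ IsWordRoot α m β n l q}

/-- `q` is the rotation element, with respect to the lift `F`, of the point of the base with
chosen lift `u`: `q = w^(1/n)`, where `F^n u = w u` with `n ≥ 1` and `w` a covering
transformation. -/
def IsRotationElement {X B : Type*} [TopologicalSpace X] (p : X → B) (F : X → X) (u : X)
    (q : FormalRoot (deckGroup p)) : Prop :=
  ∃ (n : ℕ+) (w : deckGroup p), F^[n] u = (w : X ≃ₜ X) u ∧ q = formalRoot w n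

/-!
The universal covering `X` of the graph is a tree, and the one consequence of this that the proof
uses is that every lifted edge separates: there is a continuous function `h : X → ℝ` that is the
parameter on the edge and is integral off its interior (`exists_edge_coordinate`). It is the lift
through `ℝ → ℝ/ℤ` of the map that wraps this one lifted edge around the circle and collapses
everything else. With these coordinates a reduced edge path in `X` is seen to pass no edge twice
(`IsReducedPath.ne_of_lt`), so that `h` increases from `0` to `1` between its end points for every
edge that it passes. Since the lift `ft` of `f` agrees with the lift `Lt` of the linearization over
the vertices, the path `ft ∘ γ` crosses every edge that the linearized path `Lt ∘ γ` passes
(`Tracks.exists_step`): some subinterval of `γ` is mapped by `ft` across that edge (`Crosses`).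
Moreover this subinterval contains an end of `γ` only if the corresponding subinterval for `Lt`
does.

Crossings compose like the arrows of a Markov graph and are compatible with the covering
transformations. The orbit of the point `y` under `L` yields a crossing from the lifted edge to its
`β`-translate under `ft^n`, and the hypothesis that `L^m(E)` begins with `E` yields a crossing to
the `α`-translate under `ft^m`. For a word `v` in `α` and `β` the composed crossing goes from the
lifted edge to its `v`-translate, and the intermediate value theorem gives a point `z` with
`ft^N z = v z`.

It remains to see that `z` is interior. If the composed crossing reverses the edge this is
automatic. If it preserves the orientation and the word contains `β`, both ends of the edge are
avoided because an affine map with an interior fixed point that is not an isometry of the edge is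
expanding (`crosses_of_interior_fixed`, `crosses_word`, `crosses_word_of_reverse`). Two cases are
left. If `L^n` is the identity on the edge, every word is realized by the vertex `x`
(`iterate_wordLength_eq`). If `L^n` flips the edge, then `L^m` fixes both of its ends, all words
have the same formal root as `β`, and `β` itself is realized by a reversing crossing
(`formalRoot_wordValue_eq_of_swap`).
-/

namespace MultiDigraph

variable {V E X : Type*} {G : MultiDigraph V E}

/-! ### Points of the graph -/

/-- The position `(e, t)` of a point in the interior of an edge, and `none` at a vertex. -/
noncomputable def interiorCoord (G : MultiDigraph V E) : G.Space → Option (E × I) :=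
  Quot.lift (Sum.elim (fun _ => none)
    (fun a => open Classical in if a.2 ∈ Set.Ioo (0 : I) 1 then some a else none)) (by
      rintro _ _ (e | e) <;> simp)

theorem interiorCoord_edge {e : E} {t : I} (ht : t ∈ Set.Ioo (0 : I) 1) :
    G.interiorCoord (G.edge e t) = some (e, t) :=
  if_pos ht

theorem edge_injective_of_mem_Ioo {e e' : E} {s t : I} (hs : s ∈ Set.Ioo (0 : I) 1)
    (h : G.edge e s = G.edge e' t) : e = e' ∧ s = t := by
  have h1 := congrArg G.interiorCoord h
  rw [interiorCoord_edge hs] at h1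
  by_cases ht : t ∈ Set.Ioo (0 : I) 1
  · rw [interiorCoord_edge ht] at h1
    simpa using h1
  · have : G.interiorCoord (G.edge e' t) = none := if_neg ht
    rw [this] at h1
    simp at h1

theorem edge_notMem_vertices {e : E} {t : I} (ht : t ∈ Set.Ioo (0 : I) 1) :
    G.edge e t ∉ G.vertices := by
  rintro ⟨v, hv⟩
  have h1 := congrArg G.interiorCoord hv
  rw [interiorCoord_edge ht] at h1
  exact absurd h1 (by simp [interiorCoord, vertex])

theorem edge_mem_vertices {e : E} {t : I} (ht : t ∉ Set.Ioo (0 : I) 1) :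
    G.edge e t ∈ G.vertices := by
  rcases eq_or_ne t 0 with rfl | h0
  · exact ⟨_, (G.edge_zero e).symm⟩
  rcases eq_or_ne t 1 with rfl | h1
  · exact ⟨_, (G.edge_one e).symm⟩
  exact absurd ⟨unitInterval.pos_iff_ne_zero.2 h0, unitInterval.lt_one_iff_ne_one.2 h1⟩ ht

theorem isOpenEmbedding_edge_Ioo (e : E) :
    Topology.IsOpenEmbedding (fun t : Set.Ioo (0 : I) 1 => G.edge e t) := by
  refine .of_continuous_injective_isOpenMap (by fun_prop) ?_ ?_
  · intro s t h
    exact Subtype.ext (edge_injective_of_mem_Ioo s.2 h).2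
  · intro U hU
    let _ : TopologicalSpace V := ⊥
    let _ : TopologicalSpace E := ⊥
    have : DiscreteTopology E := ⟨rfl⟩
    have hU' : IsOpen ((↑) '' U : Set I) := isOpen_Ioo.isOpenMap_subtype_val U hU
    have key : (Quot.mk G.Glue ⁻¹' ((fun t : Set.Ioo (0 : I) 1 => G.edge e t) '' U)) =
        Sum.inr '' (({e} : Set E) ×ˢ ((↑) '' U : Set I)) := by
      ext z
      constructor
      · rintro ⟨t, htU, ht⟩
        have h1 := congrArg G.interiorCoord ht
        rw [interiorCoord_edge t.2] at h1
        rcases z with v | ⟨e', s⟩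
        · exact absurd h1 (by simp [interiorCoord])
        · have h2 : G.edge e t = G.edge e' s := ht
          obtain ⟨rfl, h3⟩ := edge_injective_of_mem_Ioo t.2 h2
          exact ⟨(e, s), ⟨rfl, t, htU, h3⟩, rfl⟩
      · rintro ⟨⟨_, _⟩, ⟨rfl, t, htU, rfl⟩, rfl⟩
        exact ⟨t, htU, rfl⟩
    refine isOpen_coinduced.2 ?_
    exact key ▸ isOpenMap_inr _ ((isOpen_discrete _).prod hU')

instance : LocallyPathConnectedSpace G.Space := by
  let _ : TopologicalSpace V := ⊥
  let _ : TopologicalSpace E := ⊥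
  have : DiscreteTopology V := ⟨rfl⟩
  have : DiscreteTopology E := ⟨rfl⟩
  have : LocallyPathConnectedSpace I := (convex_Icc (0 : ℝ) 1).locallyPathConnectedSpace
  exact inferInstanceAs (LocallyPathConnectedSpace (Quot G.Glue))

theorem symm_mem_Ioo {t : I} : σ t ∈ Set.Ioo (0 : I) 1 ↔ t ∈ Set.Ioo (0 : I) 1 := by
  simp only [Set.mem_Ioo, ← Subtype.coe_lt_coe, unitInterval.coe_symm_eq, Set.Icc.coe_zero,
    Set.Icc.coe_one, sub_pos, sub_lt_self_iff]
  exact and_comm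

theorem orientedEdge_not (a : E × Bool) (t : I) :
    G.orientedEdge (a.1, !a.2) t = G.orientedEdge a (σ t) := by
  obtain ⟨e, _ | _⟩ := a <;> simp [orientedEdge]

theorem orientedEdge_injective_of_mem_Ioo {a b : E × Bool} {s t : I}
    (hs : s ∈ Set.Ioo (0 : I) 1) (h : G.orientedEdge a s = G.orientedEdge b t) :
    (b = a ∧ t = s) ∨ (b = (a.1, !a.2) ∧ t = σ s) := by
  have hs' : σ s ∈ Set.Ioo (0 : I) 1 :=
    symm_mem_Ioo.2 hs
  obtain ⟨e, _ | _⟩ := a <;> obtain ⟨e', _ | _⟩ := b <;>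
    simp only [orientedEdge, if_true, Bool.false_eq_true, if_false] at h
  · obtain ⟨rfl, h'⟩ := edge_injective_of_mem_Ioo hs' h
    simp [unitInterval.symm_inj.1 h']
  · obtain ⟨rfl, h'⟩ := edge_injective_of_mem_Ioo hs' h
    simp [h']
  · obtain ⟨rfl, h'⟩ := edge_injective_of_mem_Ioo hs h
    simp [h']
  · obtain ⟨rfl, h'⟩ := edge_injective_of_mem_Ioo hs h
    simp [h']

theorem orientedEdge_mem_vertices {a : E × Bool} {t : I} (ht : t ∉ Set.Ioo (0 : I) 1) :
    G.orientedEdge a t ∈ G.vertices := by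
  have ht' : σ t ∉ Set.Ioo (0 : I) 1 := mt symm_mem_Ioo.1 ht
  unfold orientedEdge
  split_ifs
  exacts [edge_mem_vertices ht, edge_mem_vertices ht']

theorem orientedEdge_notMem_vertices {a : E × Bool} {t : I} (ht : t ∈ Set.Ioo (0 : I) 1) :
    G.orientedEdge a t ∉ G.vertices := by
  have ht' : σ t ∈ Set.Ioo (0 : I) 1 := symm_mem_Ioo.2 ht
  unfold orientedEdge
  split_ifs
  exacts [edge_notMem_vertices ht, edge_notMem_vertices ht']

/-! ### Lifts of edges to the covering -/

variable [TopologicalSpace X] {p : X → G.Space}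

/-- `γ` is a lift of the oriented edge `a` along the projection `p`. -/
def IsEdgeLift (p : X → G.Space) (a : E × Bool) (γ : C(I, X)) : Prop :=
  ∀ t, p (γ t) = G.orientedEdge a t

/-- The path `γ` run through backwards. -/
def reversePath (γ : C(I, X)) : C(I, X) := γ.comp ⟨σ, unitInterval.continuous_symm⟩

@[simp] theorem reversePath_apply (γ : C(I, X)) (t : I) : reversePath γ t = γ (σ t) := rfl

@[simp] theorem reversePath_reversePath (γ : C(I, X)) : reversePath (reversePath γ) = γ := by
  ext t; simp

theorem IsEdgeLift.reverse {a : E × Bool} {γ : C(I, X)} (h : IsEdgeLift p a γ) :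
    IsEdgeLift p (a.1, !a.2) (reversePath γ) := fun t => by
  rw [orientedEdge_not, ← h, reversePath_apply]

theorem IsEdgeLift.mem_vertices {a : E × Bool} {γ : C(I, X)} (h : IsEdgeLift p a γ) {t : I}
    (ht : t ∉ Set.Ioo (0 : I) 1) : p (γ t) ∈ G.vertices := by
  rw [h]; exact orientedEdge_mem_vertices ht

theorem IsEdgeLift.notMem_vertices {a : E × Bool} {γ : C(I, X)} (h : IsEdgeLift p a γ) {t : I}
    (ht : t ∈ Set.Ioo (0 : I) 1) : p (γ t) ∉ G.vertices := by
  rw [h]; exact orientedEdge_notMem_vertices ht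

/-- Two lifted edges that meet in an interior point are equal up to orientation. -/
theorem IsEdgeLift.eq_or_eq_reverse (hp : IsCoveringMap p) {a b : E × Bool} {γ δ : C(I, X)}
    (hγ : IsEdgeLift p a γ) (hδ : IsEdgeLift p b δ) {s t : I} (hs : s ∈ Set.Ioo (0 : I) 1)
    (h : γ s = δ t) : (b = a ∧ δ = γ ∧ t = s) ∨
      (b = (a.1, !a.2) ∧ δ = reversePath γ ∧ t = σ s) := by
  have h1 := congrArg p h
  rw [hγ, hδ] at h1
  rcases orientedEdge_injective_of_mem_Ioo hs h1 with ⟨rfl, rfl⟩ | ⟨rfl, rfl⟩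
  · refine Or.inl ⟨rfl, ?_, rfl⟩
    exact DFunLike.coe_injective (hp.eq_of_comp_eq δ.continuous γ.continuous
      (funext fun u => by simp [hγ u, hδ u]) t h.symm)
  · refine Or.inr ⟨rfl, ?_, rfl⟩
    refine DFunLike.coe_injective (hp.eq_of_comp_eq δ.continuous (reversePath γ).continuous
      (funext fun u => (hδ u).trans (hγ.reverse u).symm) (σ s) ?_)
    simp [← h]

theorem isOpen_edgeLift_image_Ioo (hp : IsCoveringMap p) {e : E} {γ : C(I, X)}
    (hγ : ∀ t, p (γ t) = G.edge e t) : IsOpen (γ '' Set.Ioo (0 : I) 1) := by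
  have h1 : IsLocalHomeomorph (p ∘ fun t : Set.Ioo (0 : I) 1 => γ t) := by
    have : (p ∘ fun t : Set.Ioo (0 : I) 1 => γ t) = fun t : Set.Ioo (0 : I) 1 => G.edge e t :=
      funext fun t => hγ t
    rw [this]
    exact (isOpenEmbedding_edge_Ioo e).isLocalHomeomorph
  have h2 := (h1.of_comp hp.isLocalHomeomorph (by fun_prop)).isOpenMap
  rw [Set.image_eq_range]
  exact h2.isOpen_range

theorem exists_edgeLift_through (hp : IsCoveringMap p) (e : E) (t : I) (x : X)
    (hx : p x = G.edge e t) : ∃ γ : C(I, X), (∀ s, p (γ s) = G.edge e s) ∧ γ t = x := by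
  have : LocallyPathConnectedSpace I := (convex_Icc (0 : ℝ) 1).locallyPathConnectedSpace
  have : ContractibleSpace I := (convex_Icc (0 : ℝ) 1).contractibleSpace ⟨0, by simp⟩
  obtain ⟨γ, ⟨h1, h2⟩, -⟩ := hp.existsUnique_continuousMap_lifts (G.edge e) t x hx
  exact ⟨γ, fun s => congrFun h2 s, h1⟩

/-- The map of the graph to the circle `ℝ/ℤ` that wraps the edge `e` once around the circle and
collapses everything else. -/
noncomputable def edgeToCircle (G : MultiDigraph V E) (e : E) : G.Space → AddCircle (1 : ℝ) :=
  Quot.lift (Sum.elim (fun _ => 0)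
    (fun a => open Classical in if a.1 = e then ((a.2 : ℝ) : AddCircle (1 : ℝ)) else 0)) (by
      rintro _ _ (e | e) <;> simp)

theorem edgeToCircle_edge (e : E) (t : I) :
    G.edgeToCircle e (G.edge e t) = ((t : ℝ) : AddCircle (1 : ℝ)) := if_pos rfl

theorem continuous_edgeToCircle (e : E) : Continuous (G.edgeToCircle e) := by
  let _ : TopologicalSpace V := ⊥
  let _ : TopologicalSpace E := ⊥
  have : DiscreteTopology V := ⟨rfl⟩
  have : DiscreteTopology E := ⟨rfl⟩
  refine continuous_quot_lift _ (Continuous.sumElim continuous_const ?_)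
  refine continuous_prod_of_discrete_left.2 fun e' => ?_
  by_cases h : e' = e
  · simp only [h, if_true]
    exact (AddCircle.continuous_mk' 1).comp continuous_subtype_val
  · simp only [h, if_false]
    exact continuous_const

theorem exists_edge_of_edgeToCircle_ne_zero {e : E} {x : G.Space} (h : G.edgeToCircle e x ≠ 0) :
    ∃ t ∈ Set.Ioo (0 : I) 1, x = G.edge e t := by
  induction x using Quot.ind with
  | mk z =>
    rcases z with v | ⟨e', t⟩
    · exact absurd rfl h
    · by_cases he : e' = e
      · subst he
        have h2 : ((t : ℝ) : AddCircle (1 : ℝ)) ≠ 0 := by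
          rw [← edgeToCircle_edge (G := G) e']; exact h
        refine ⟨t, ⟨unitInterval.pos_iff_ne_zero.2 ?_, unitInterval.lt_one_iff_ne_one.2 ?_⟩, rfl⟩
        · rintro rfl; simp at h2
        · rintro rfl; simp at h2
      · exact absurd (if_neg he) h

theorem locallyPathConnectedSpace_of_isLocalHomeomorph {B : Type*} [TopologicalSpace B]
    [LocallyPathConnectedSpace B] {q : X → B} (hq : IsLocalHomeomorph q) :
    LocallyPathConnectedSpace X := by
  let _ : ChartedSpace B X :=
    { atlas := Set.univ
      chartAt := fun x => (hq x).choose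
      mem_chart_source := fun x => (hq x).choose_spec.1
      chart_mem_atlas := fun _ => trivial }
  exact ChartedSpace.locallyPathConnectedSpace B X

/-- `h` is a coordinate along the lifted edge `γ`: it restricts to the parameter of `γ` and is
integral off the interior of `γ`. -/
def IsEdgeCoordinate (γ : C(I, X)) (h : C(X, ℝ)) : Prop :=
  (∀ t : I, h (γ t) = t) ∧ ∀ x, x ∈ γ '' Set.Ioo (0 : I) 1 ∨ ∃ n : ℤ, h x = n

/-- In the simply connected covering an edge separates: there is a continuous function that
restricts to the parameter of the edge and is integral, hence locally constant, off its interior.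
It is the lift to `ℝ` of the map to the circle that wraps this lifted edge once around. -/
theorem exists_edge_coordinate [SimplyConnectedSpace X] (hp : IsCoveringMap p) {a : E × Bool}
    {γ : C(I, X)} (hγ : IsEdgeLift p a γ) : ∃ h : C(X, ℝ), IsEdgeCoordinate γ h := by
  classical
  have : LocallyPathConnectedSpace X :=
    locallyPathConnectedSpace_of_isLocalHomeomorph hp.isLocalHomeomorph
  have main : ∀ (e : E) (γ : C(I, X)), (∀ t, p (γ t) = G.edge e t) →
      ∃ h : C(X, ℝ), IsEdgeCoordinate γ h := by
    intro e γ hγ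
    set D := γ '' Set.Ioo (0 : I) 1
    have hD : IsOpen D := isOpen_edgeLift_image_Ioo hp hγ
    have hcont : Continuous (D.piecewise (G.edgeToCircle e ∘ p) (fun _ => 0)) := by
      refine Continuous.piecewise ?_ ((continuous_edgeToCircle e).comp hp.continuous)
        continuous_const
      intro x hx
      by_contra hne
      obtain ⟨t, ht, hxt⟩ := exists_edge_of_edgeToCircle_ne_zero hne
      obtain ⟨δ, hδ, rfl⟩ := exists_edgeLift_through hp e t x hxt
      rw [hD.frontier_eq] at hx
      have hδo : IsOpen (δ '' Set.Ioo (0 : I) 1) := isOpen_edgeLift_image_Ioo hp hδ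
      obtain ⟨_, ⟨s', hs', rfl⟩, ⟨s, hs, h⟩⟩ := mem_closure_iff.1 hx.1 _ hδo ⟨t, ht, rfl⟩
      have h1 : (p (γ s)) = p (δ s') := congrArg p h
      rw [hγ, hδ] at h1
      obtain ⟨-, rfl⟩ := edge_injective_of_mem_Ioo hs h1
      have : (γ : I → X) = δ := hp.eq_of_comp_eq γ.continuous δ.continuous
        (funext fun u => by simp [hγ u, hδ u]) s h
      exact hx.2 ⟨t, ht, congrFun this t⟩
    have hval : ∀ t : I, D.piecewise (G.edgeToCircle e ∘ p) (fun _ => 0) (γ t) =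
        ((t : ℝ) : AddCircle (1 : ℝ)) := by
      intro t
      by_cases ht : t ∈ Set.Ioo (0 : I) 1
      · rw [Set.piecewise_eq_of_mem _ _ _ (Set.mem_image_of_mem γ ht), Function.comp_apply, hγ,
          edgeToCircle_edge]
      · have hnot : γ t ∉ D := by
          rintro ⟨s, hs, h⟩
          apply edge_notMem_vertices (G := G) (e := e) hs
          rw [← hγ, h, hγ]
          exact edge_mem_vertices ht
        rw [Set.piecewise_eq_of_notMem _ _ _ hnot]
        rcases eq_or_ne t 0 with rfl | h0
        · simp
        rcases eq_or_ne t 1 with rfl | h1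
        · simpa using (AddCircle.coe_period (1 : ℝ)).symm
        exact absurd ⟨unitInterval.pos_iff_ne_zero.2 h0, unitInterval.lt_one_iff_ne_one.2 h1⟩ ht
    have hcov : IsCoveringMap ((↑) : ℝ → AddCircle (1 : ℝ)) := AddCircle.isCoveringMap_coe 1
    obtain ⟨h, ⟨h0, h1⟩, -⟩ := hcov.existsUnique_continuousMap_lifts ⟨_, hcont⟩ (γ 0) 0 (by
      have := hval 0
      simpa using this.symm)
    refine ⟨h, ?_, ?_⟩
    · have : (fun t : I => h (γ t)) = fun t : I => (t : ℝ) :=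
        hcov.eq_of_comp_eq (by fun_prop) (by fun_prop)
          (funext fun t => (congrFun h1 (γ t)).trans (hval t)) 0 (by simpa using h0)
      exact fun t => congrFun this t
    · intro x
      by_cases hx : x ∈ D
      · exact Or.inl hx
      · right
        have h2 : ((h x : ℝ) : AddCircle (1 : ℝ)) = 0 :=
          (congrFun h1 x).trans (Set.piecewise_eq_of_notMem D _ _ hx :
            D.piecewise (G.edgeToCircle e ∘ p) (fun _ => 0) x = 0)
        obtain ⟨n, hn⟩ := (AddCircle.coe_eq_zero_iff (1 : ℝ)).1 h2
        exact ⟨n, by simpa using hn.symm⟩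
  obtain ⟨e, _ | _⟩ := a
  · obtain ⟨h, h1, h2⟩ := main e (reversePath γ) (fun t => hγ.reverse t)
    refine ⟨⟨fun x => 1 - h x, by fun_prop⟩, fun t => ?_, fun x => ?_⟩
    · have := h1 (σ t)
      simp only [reversePath_apply, unitInterval.symm_symm, unitInterval.coe_symm_eq] at this
      simp [this]
    · rcases h2 x with ⟨t, ht, rfl⟩ | ⟨n, hn⟩
      · exact Or.inl ⟨σ t, symm_mem_Ioo.2 ht, rfl⟩
      · exact Or.inr ⟨1 - n, by simp [hn]⟩
  · exact main e γ (fun t => hγ t)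

/-! ### Separation properties -/

/-- The function on the graph that is `1` at the vertex `v`, `0` at the other vertices, and affine
on the edges. -/
noncomputable def tent (G : MultiDigraph V E) (v : V) : G.Space → ℝ :=
  open Classical in
  Quot.lift (Sum.elim (fun w => if w = v then 1 else 0)
    (fun a => (1 - (a.2 : ℝ)) * (if G.src a.1 = v then 1 else 0) +
      a.2 * (if G.tgt a.1 = v then 1 else 0))) (by
      rintro _ _ (e | e) <;> simp)

theorem continuous_tent (v : V) : Continuous (G.tent v) := by
  let _ : TopologicalSpace V := ⊥
  let _ : TopologicalSpace E := ⊥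
  have : DiscreteTopology V := ⟨rfl⟩
  have : DiscreteTopology E := ⟨rfl⟩
  refine continuous_quot_lift _ (Continuous.sumElim continuous_of_discreteTopology ?_)
  refine continuous_prod_of_discrete_left.2 fun e => ?_
  dsimp only
  split_ifs <;> fun_prop

theorem exists_eq_vertex_or_edge (x : G.Space) :
    (∃ v, x = G.vertex v) ∨ ∃ e, ∃ t ∈ Set.Ioo (0 : I) 1, x = G.edge e t := by
  induction x using Quot.ind with
  | mk z =>
    rcases z with v | ⟨e, t⟩
    · exact Or.inl ⟨v, rfl⟩
    · by_cases ht : t ∈ Set.Ioo (0 : I) 1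
      · exact Or.inr ⟨e, t, ht, rfl⟩
      · obtain ⟨v, hv⟩ := edge_mem_vertices (G := G) (e := e) ht
        exact Or.inl ⟨v, hv.symm⟩

theorem eq_of_edgeToCircle_eq {e : E} {t : I} (ht : t ∈ Set.Ioo (0 : I) 1) {x : G.Space}
    (h : G.edgeToCircle e (G.edge e t) = G.edgeToCircle e x) : G.edge e t = x := by
  have key : ∀ s : I, s ∈ Set.Ioo (0 : I) 1 → (s : ℝ) ∈ Set.Ico (0 : ℝ) (0 + 1) := fun s hs =>
    ⟨s.2.1, by simpa using (Subtype.coe_lt_coe.2 hs.2)⟩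
  have : Fact ((0 : ℝ) < 1) := ⟨one_pos⟩
  have hne : G.edgeToCircle e x ≠ 0 := by
    rw [← h, edgeToCircle_edge]
    intro h0
    have h1 := (AddCircle.coe_eq_coe_iff_of_mem_Ico (p := (1 : ℝ)) (a := 0) (key t ht)
      (y := 0) (by simp)).1 (by simpa using h0)
    exact absurd (Subtype.coe_lt_coe.2 ht.1) (by simp [h1])
  obtain ⟨s, hs, rfl⟩ := exists_edge_of_edgeToCircle_ne_zero hne
  rw [edgeToCircle_edge, edgeToCircle_edge] at h
  rw [Subtype.ext ((AddCircle.coe_eq_coe_iff_of_mem_Ico (key t ht) (key s hs)).1 h)]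

instance : T2Space G.Space := by
  have : Fact ((0 : ℝ) < 1) := ⟨one_pos⟩
  refine ⟨fun x y hxy => ?_⟩
  rcases exists_eq_vertex_or_edge x with ⟨v, rfl⟩ | ⟨e, t, ht, rfl⟩
  · rcases exists_eq_vertex_or_edge y with ⟨w, rfl⟩ | ⟨e, t, ht, rfl⟩
    · refine separated_by_continuous (continuous_tent v) ?_
      have hwv : w ≠ v := by rintro rfl; exact hxy rfl
      simp [tent, vertex, hwv]
    · exact separated_by_continuous (continuous_edgeToCircle e)
        fun h => hxy (eq_of_edgeToCircle_eq ht h.symm).symm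
  · exact separated_by_continuous (continuous_edgeToCircle e)
      fun h => hxy (eq_of_edgeToCircle_eq ht h)

theorem _root_.IsCoveringMap.t2Space {B : Type*} [TopologicalSpace B] [T2Space B] {q : X → B}
    (hq : IsCoveringMap q) : T2Space X := by
  refine ⟨fun x y hxy => ?_⟩
  by_cases h : q x = q y
  · exact hq.isSeparatedMap x y h hxy
  · exact separated_by_continuous hq.continuous h

/-! ### Reduced paths in the covering -/

theorem isDiscrete_range_intCast : IsDiscrete (Set.range ((↑) : ℤ → ℝ)) :=
  isDiscrete_iff_discreteTopology.2
    Int.isClosedEmbedding_coe_real.isEmbedding.toHomeomorph.symm.isEmbedding.discreteTopology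

/-- The coordinate along a lifted edge is constant on every other lifted edge, as it takes integral
values there. -/
theorem IsEdgeCoordinate.eq_of_ne (hp : IsCoveringMap p) {a b : E × Bool} {γ δ : C(I, X)}
    {h : C(X, ℝ)} (hh : IsEdgeCoordinate γ h) (hγ : IsEdgeLift p a γ) (hδ : IsEdgeLift p b δ)
    (h1 : δ ≠ γ) (h2 : δ ≠ reversePath γ) (s t : I) : h (δ s) = h (δ t) := by
  have hdisc : IsDiscrete (Set.range ((↑) : ℤ → ℝ)) :=
    isDiscrete_range_intCast
  refine isPreconnected_univ.constant_of_mapsTo (f := fun t => h (δ t)) hdisc (by fun_prop)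
    (fun u _ => ?_) (Set.mem_univ s) (Set.mem_univ t)
  rcases hh.2 (δ u) with ⟨v, hv, hvu⟩ | ⟨n, hn⟩
  · rcases hγ.eq_or_eq_reverse hp hδ hv hvu with h3 | h3
    · exact absurd h3.2.1 h1
    · exact absurd h3.2.1 h2
  · exact ⟨n, hn.symm⟩

/-- The paths `δ 0, …, δ (k - 1)` are lifted edges that form an edge path without backtracking. -/
structure IsReducedPath (p : X → G.Space) (k : ℕ) (δ : ℕ → C(I, X)) : Prop where
  lift : ∀ i < k, ∃ a, IsEdgeLift p a (δ i)
  link : ∀ i, i + 1 < k → δ i 1 = δ (i + 1) 0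
  reduced : ∀ i, i + 1 < k → δ (i + 1) ≠ reversePath (δ i)

namespace IsReducedPath

variable {k : ℕ} {δ : ℕ → C(I, X)}

theorem coordinate_eq (hp : IsCoveringMap p) (hδ : IsReducedPath p k δ) {a : E × Bool}
    {γ : C(I, X)} (hγ : IsEdgeLift p a γ) {h : C(X, ℝ)} (hh : IsEdgeCoordinate γ h) {i j : ℕ}
    (hij : i ≤ j) (hj : j < k)
    (hne : ∀ l, i < l → l ≤ j → δ l ≠ γ ∧ δ l ≠ reversePath γ) : h (δ i 1) = h (δ j 1) := by
  induction j, hij using Nat.le_induction with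
  | base => rfl
  | succ j hij ih =>
    rw [ih (by omega) fun l h1 h2 => hne l h1 (by omega), hδ.link j hj]
    obtain ⟨b, hb⟩ := hδ.lift (j + 1) hj
    exact hh.eq_of_ne hp hγ hb (hne _ (by omega) le_rfl).1 (hne _ (by omega) le_rfl).2 _ _

theorem coordinate_eq' (hp : IsCoveringMap p) (hδ : IsReducedPath p k δ) {a : E × Bool}
    {γ : C(I, X)} (hγ : IsEdgeLift p a γ) {h : C(X, ℝ)} (hh : IsEdgeCoordinate γ h) {i j : ℕ}
    (hij : i ≤ j) (hj : j < k)
    (hne : ∀ l, i ≤ l → l < j → δ l ≠ γ ∧ δ l ≠ reversePath γ) : h (δ i 0) = h (δ j 0) := by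
  induction j, hij using Nat.le_induction with
  | base => rfl
  | succ j hij ih =>
    rw [ih (by omega) fun l h1 h2 => hne l h1 (by omega), ← hδ.link j hj]
    obtain ⟨b, hb⟩ := hδ.lift j (by omega)
    exact hh.eq_of_ne hp hγ hb (hne _ hij (by omega)).1 (hne _ hij (by omega)).2 _ _

variable [SimplyConnectedSpace X]

/-- A reduced edge path in the simply connected covering passes every edge at most once. -/
theorem ne_of_lt (hp : IsCoveringMap p) (hδ : IsReducedPath p k δ) (d : ℕ) :
    ∀ i, i + d + 1 < k → δ (i + d + 1) ≠ δ i ∧ δ (i + d + 1) ≠ reversePath (δ i) := by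
  induction d using Nat.strong_induction_on with
  | _ d ih =>
    intro i hi
    -- The edge `δ i` is not met again up to `δ (i + d)`, so its coordinate is still `1` there.
    have key : ∀ i' d' : ℕ, i ≤ i' → i' + d' ≤ i + d → ∀ h : C(X, ℝ), IsEdgeCoordinate (δ i') h →
        h (δ (i' + d') 1) = 1 := by
      intro i' d' h1 h2 h hh
      obtain ⟨a, ha⟩ := hδ.lift i' (by omega)
      rw [← hδ.coordinate_eq hp ha hh (Nat.le_add_right i' d') (by omega), hh.1]
      · simp
      · intro l hl1 hl2
        obtain ⟨c, rfl⟩ : ∃ c, l = i' + c + 1 := ⟨l - i' - 1, by omega⟩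
        exact ih c (by omega) i' (by omega)
    constructor
    · intro heq
      obtain ⟨a, ha⟩ := hδ.lift i (by omega)
      obtain ⟨h, hh⟩ := exists_edge_coordinate hp ha
      have h1 := key i d le_rfl le_rfl h hh
      rw [hδ.link (i + d) hi, heq, hh.1] at h1
      simp at h1
    · intro heq
      rcases d with _ | d
      · exact hδ.reduced i hi heq
      · -- The edges strictly between `δ i` and its inverse form a closed path that starts with
        -- `δ (i + 1)` and does not meet this edge again.
        obtain ⟨a, ha⟩ := hδ.lift (i + 1) (by omega)
        obtain ⟨h, hh⟩ := exists_edge_coordinate hp ha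
        have h1 := key (i + 1) d (by omega) (by omega) h hh
        have h2 : i + 1 + d = i + (d + 1) := by omega
        rw [h2, hδ.link (i + (d + 1)) hi, heq, reversePath_apply, unitInterval.symm_zero,
          hδ.link i (by omega), hh.1] at h1
        simp at h1

theorem coordinate_zero (hp : IsCoveringMap p) (hδ : IsReducedPath p k δ) {i : ℕ} (hi : i < k)
    {h : C(X, ℝ)} (hh : IsEdgeCoordinate (δ i) h) {j : ℕ} (hj : j ≤ i) : h (δ j 0) = 0 := by
  obtain ⟨a, ha⟩ := hδ.lift i hi
  rw [hδ.coordinate_eq' hp ha hh hj hi, hh.1]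
  · simp
  · intro l hl1 hl2
    obtain ⟨c, rfl⟩ : ∃ c, i = l + c + 1 := ⟨i - l - 1, by omega⟩
    obtain ⟨h1, h2⟩ := hδ.ne_of_lt hp c l hi
    exact ⟨fun h3 => h1 h3.symm, fun h3 => h2 (by rw [h3, reversePath_reversePath])⟩

theorem coordinate_one (hp : IsCoveringMap p) (hδ : IsReducedPath p k δ) {i : ℕ}
    {h : C(X, ℝ)} (hh : IsEdgeCoordinate (δ i) h) {j : ℕ} (hij : i ≤ j) (hj : j < k) :
    h (δ j 1) = 1 := by
  obtain ⟨a, ha⟩ := hδ.lift i (by omega)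
  rw [← hδ.coordinate_eq hp ha hh hij hj, hh.1]
  · simp
  · intro l hl1 hl2
    obtain ⟨c, rfl⟩ : ∃ c, l = i + c + 1 := ⟨l - i - 1, by omega⟩
    exact hδ.ne_of_lt hp c i (by omega)

end IsReducedPath

/-! ### Crossing an edge -/

/-- On a path of real values from at most `a` to at least `b` there is a subinterval on which the
path runs from `a` to `b` and stays strictly between `a` and `b` in the interior. -/
theorem exists_crossing_interval {w : I → ℝ} (hw : Continuous w) {s₀ t₀ : I} {a b : ℝ}
    (hst : s₀ ≤ t₀) (hs : w s₀ ≤ a) (ht : b ≤ w t₀) (hab : a < b) :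
    ∃ s t : I, s₀ ≤ s ∧ s < t ∧ t ≤ t₀ ∧ w s = a ∧ w t = b ∧
      ∀ x ∈ Set.Ioo s t, w x ∈ Set.Ioo a b := by
  -- `t` is the first parameter with value at least `b`.
  have hK : IsCompact (Set.Icc s₀ t₀ ∩ w ⁻¹' Set.Ici b) :=
    (isClosed_Icc.inter (isClosed_Ici.preimage hw)).isCompact
  obtain ⟨t, ⟨⟨ht1, ht2⟩, ht3⟩, htmin⟩ := hK.exists_isLeast ⟨t₀, ⟨hst, le_rfl⟩, ht⟩
  have hwt : w t = b := by
    obtain ⟨x, hx, hxb⟩ := intermediate_value_Icc ht1 hw.continuousOn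
      (show b ∈ Set.Icc (w s₀) (w t) from ⟨hs.trans hab.le, ht3⟩)
    have : t ≤ x := htmin ⟨⟨hx.1, hx.2.trans ht2⟩, hxb.ge⟩
    rw [le_antisymm this hx.2, hxb]
  -- `s` is the last parameter before `t` with value at most `a`.
  have hK' : IsCompact (Set.Icc s₀ t ∩ w ⁻¹' Set.Iic a) :=
    (isClosed_Icc.inter (isClosed_Iic.preimage hw)).isCompact
  obtain ⟨s, ⟨⟨hs1, hs2⟩, hs3⟩, hsmax⟩ := hK'.exists_isGreatest ⟨s₀, ⟨le_rfl, ht1⟩, hs⟩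
  have hws : w s = a := by
    obtain ⟨x, hx, hxa⟩ := intermediate_value_Icc hs2 hw.continuousOn
      (show a ∈ Set.Icc (w s) (w t) from ⟨hs3, hab.le.trans ht3⟩)
    have : x ≤ s := hsmax ⟨⟨hs1.trans hx.1, hx.2⟩, hxa.le⟩
    rw [le_antisymm hx.1 this, hxa]
  refine ⟨s, t, hs1, lt_of_le_of_ne hs2 ?_, ht2, hws, hwt, fun x hx => ⟨?_, ?_⟩⟩
  · rintro rfl; linarith
  · by_contra hxa
    exact absurd (hsmax ⟨⟨hs1.trans hx.1.le, hx.2.le⟩, not_lt.1 hxa⟩) (not_le.2 hx.1)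
  · by_contra hxb
    exact absurd (htmin ⟨⟨hs1.trans hx.1.le, hx.2.le.trans ht2⟩, not_lt.1 hxb⟩) (not_le.2 hx.2)

/-- `F` maps a subinterval `[s, t]` of the path `γ` across the path `δ`, from its initial to its
terminal point. The propositions `P` and `Q` record when `[s, t]` is known to avoid the initial,
respectively the terminal, point of `γ`. -/
def Crosses (F : X → X) (γ δ : C(I, X)) (P Q : Prop) : Prop :=
  ∃ (s t : I) (u : C(I, I)), s < t ∧ u s = 0 ∧ u t = 1 ∧
    (∀ x ∈ Set.Icc s t, F (γ x) = δ (u x)) ∧ (P → 0 < s) ∧ (Q → t < 1)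

namespace Crosses

variable {F F' : X → X} {γ δ ε : C(I, X)} {P Q P' Q' : Prop}

theorem refl (γ : C(I, X)) : Crosses id γ γ False False :=
  ⟨0, 1, .id I, one_pos, rfl, rfl, fun _ _ => rfl, False.elim, False.elim⟩

theorem mono (h : Crosses F γ δ P Q) (hP : P' → P) (hQ : Q' → Q) : Crosses F γ δ P' Q' := by
  obtain ⟨s, t, u, h1, h2, h3, h4, h5, h6⟩ := h
  exact ⟨s, t, u, h1, h2, h3, h4, h5 ∘ hP, h6 ∘ hQ⟩

theorem comp (h : Crosses F γ δ P Q) (h' : Crosses F' δ ε P' Q') :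
    Crosses (F' ∘ F) γ ε (P ∨ P') (Q ∨ Q') := by
  obtain ⟨s, t, u, hst, hs, ht, hF, hP, hQ⟩ := h
  obtain ⟨s', t', u', hst', hs', ht', hF', hP', hQ'⟩ := h'
  obtain ⟨s₁, t₁, h1, h2, h3, h4, h5, h6⟩ := exists_crossing_interval
    (w := fun x => (u x : ℝ)) (by fun_prop) hst.le (a := s') (b := t')
    (by simpa [hs] using s'.2.1) (by simpa [ht] using t'.2.2) hst'
  have h4' : u s₁ = s' := Subtype.ext h4
  have h5' : u t₁ = t' := Subtype.ext h5
  refine ⟨s₁, t₁, u'.comp u, h2, by simp [h4', hs'], by simp [h5', ht'], ?_, ?_, ?_⟩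
  · intro x hx
    have hu : u x ∈ Set.Icc s' t' := by
      rcases eq_or_lt_of_le hx.1 with rfl | hx1
      · rw [h4']; exact ⟨le_rfl, hst'.le⟩
      rcases eq_or_lt_of_le hx.2 with rfl | hx2
      · rw [h5']; exact ⟨hst'.le, le_rfl⟩
      exact ⟨(h6 x ⟨hx1, hx2⟩).1.le, (h6 x ⟨hx1, hx2⟩).2.le⟩
    rw [Function.comp_apply, hF x ⟨h1.trans hx.1, hx.2.trans h3⟩, hF' _ hu]
    rfl
  · rintro (hp | hp)
    · exact (hP hp).trans_le h1
    · refine lt_of_le_of_ne (Subtype.coe_le_coe.1 s₁.2.1) ?_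
      rintro rfl
      have : s = 0 := le_antisymm h1 s.2.1
      subst this
      exact (hP' hp).ne (by rw [← h4', hs])
  · rintro (hq | hq)
    · exact h3.trans_lt (hQ hq)
    · refine lt_of_le_of_ne (Subtype.coe_le_coe.1 t₁.2.2) ?_
      rintro rfl
      have : t = 1 := le_antisymm t.2.2 h3
      subst this
      exact (hQ' hq).ne (by rw [← h5', ht])

theorem reverse (h : Crosses F γ δ P Q) :
    Crosses F (reversePath γ) (reversePath δ) Q P := by
  obtain ⟨s, t, u, hst, hs, ht, hF, hP, hQ⟩ := h
  refine ⟨σ t, σ s, (⟨σ, unitInterval.continuous_symm⟩ : C(I, I)).comp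
    (u.comp ⟨σ, unitInterval.continuous_symm⟩), unitInterval.symm_lt_symm.2 hst, by simp [ht],
    by simp [hs], fun x hx => ?_, fun hq => ?_, fun hp => ?_⟩
  · simp only [reversePath_apply, ContinuousMap.comp_apply, ContinuousMap.coe_mk,
      unitInterval.symm_symm]
    exact hF _ ⟨unitInterval.le_symm_comm.1 hx.2, unitInterval.symm_le_comm.1 hx.1⟩
  · rw [← unitInterval.symm_one]; exact unitInterval.symm_lt_symm.2 (hQ hq)
  · rw [← unitInterval.symm_zero]; exact unitInterval.symm_lt_symm.2 (hP hp)

theorem map_comp (h : Crosses F γ δ P Q) (g : C(X, X)) (hg : ∀ x, F (g x) = g (F x)) :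
    Crosses F (g.comp γ) (g.comp δ) P Q := by
  obtain ⟨s, t, u, hst, hs, ht, hF, hP, hQ⟩ := h
  exact ⟨s, t, u, hst, hs, ht, fun x hx => by simp [hg, hF x hx], hP, hQ⟩

/-- A path whose interior subinterval is mapped across a translate of the path has an interior
point that is mapped to its translate. -/
theorem exists_mem_Ioo_eq {g : C(X, X)} (h : Crosses F γ (g.comp γ) True True) :
    ∃ z ∈ Set.Ioo (0 : I) 1, F (γ z) = g (γ z) := by
  obtain ⟨s, t, u, hst, hs, ht, hF, hP, hQ⟩ := h
  have h0 : (0 : ℝ) < s := hP trivial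
  have h1 : (t : ℝ) < 1 := hQ trivial
  obtain ⟨z, hz, hz0⟩ := intermediate_value_Icc hst.le
    (f := fun x : I => (u x : ℝ) - x) (by fun_prop) (show (0 : ℝ) ∈ Set.Icc _ _ from
      ⟨by simpa [hs] using h0.le, by simpa [ht] using h1.le⟩)
  have huz : u z = z := Subtype.ext (sub_eq_zero.1 hz0)
  exact ⟨z, ⟨(hP trivial).trans_le hz.1, hz.2.trans_lt (hQ trivial)⟩, by rw [hF z hz, huz]; rfl⟩

/-- If a subinterval is mapped across a translate of the reversed path, then the fixed point is
automatically an interior one. -/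
theorem exists_mem_Ioo_eq_of_reverse {g : C(X, X)}
    (h : Crosses F γ (g.comp (reversePath γ)) P Q) :
    ∃ z ∈ Set.Ioo (0 : I) 1, F (γ z) = g (γ z) := by
  obtain ⟨s, t, u, hst, hs, ht, hF, -, -⟩ := h
  obtain ⟨z, hz, hz0⟩ := intermediate_value_Icc hst.le
    (f := fun x : I => (u x : ℝ) + x) (by fun_prop) (show (1 : ℝ) ∈ Set.Icc _ _ from
      ⟨by simpa [hs] using s.2.2, by simpa [ht] using t.2.1⟩)
  have huz : u z = σ z := Subtype.ext (by
    rw [unitInterval.coe_symm_eq]; simp only at hz0; linarith)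
  refine ⟨z, ⟨lt_of_le_of_ne z.2.1 ?_, lt_of_le_of_ne z.2.2 ?_⟩, by rw [hF z hz, huz]; simp⟩
  · rintro rfl
    have : s = 0 := le_antisymm hz.1 s.2.1
    subst this
    simp [hs] at huz
  · rintro rfl
    have : t = 1 := le_antisymm t.2.2 hz.2
    subst this
    simp [ht] at huz

/-- A path along which the coordinate of the lifted edge `δ` increases from `0` to `1` crosses this
edge. -/
theorem of_coordinate [T2Space X] (hF : Continuous F) {h : C(X, ℝ)} (hh : IsEdgeCoordinate δ h)
    (h0 : h (F (γ 0)) = 0) (h1 : h (F (γ 1)) = 1) (hP : P → F (γ 0) ≠ δ 0)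
    (hQ : Q → F (γ 1) ≠ δ 1) : Crosses F γ δ P Q := by
  have hw : Continuous fun x => h (F (γ x)) := by fun_prop
  obtain ⟨s, t, -, hst, -, hs, ht, hin⟩ :=
    exists_crossing_interval hw (zero_le_one : (0 : I) ≤ 1) h0.le h1.ge one_pos
  let u : C(I, I) := ⟨fun x => Set.projIcc 0 1 zero_le_one (h (F (γ x))), by fun_prop⟩
  have hus : u s = 0 := by
    simp only [u, ContinuousMap.coe_mk, hs]; exact Set.projIcc_left zero_le_one
  have hut : u t = 1 := by
    simp only [u, ContinuousMap.coe_mk, ht]; exact Set.projIcc_right zero_le_one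
  have hopen : Set.EqOn (fun x => F (γ x)) (fun x => δ (u x)) (Set.Ioo s t) := by
    intro x hx
    obtain ⟨hx0, hx1⟩ := hin x hx
    rcases hh.2 (F (γ x)) with ⟨v, -, hv⟩ | ⟨n, hn⟩
    · have hvx : h (F (γ x)) = v := by rw [← hv, hh.1]
      have : u x = v := by
        simp only [u, ContinuousMap.coe_mk, hvx]; exact Set.projIcc_val _ v
      simp only [this, hv]
    · rw [hn] at hx0 hx1
      have h2 : (0 : ℤ) < n := by exact_mod_cast hx0
      have h3 : n < (1 : ℤ) := by exact_mod_cast hx1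
      omega
  have hclosed := hopen.closure (by fun_prop) (by fun_prop)
  rw [closure_Ioo hst.ne] at hclosed
  refine ⟨s, t, u, hst, hus, hut, hclosed, fun hp => ?_, fun hq => ?_⟩
  · refine lt_of_le_of_ne s.2.1 fun h2 => hP hp ?_
    have h3 := hclosed ⟨le_rfl, hst.le⟩
    simp only [hus] at h3
    rwa [← h2] at h3
  · refine lt_of_le_of_ne t.2.2 fun h2 => hQ hq ?_
    have h3 := hclosed ⟨hst.le, le_rfl⟩
    simp only [hut] at h3
    rwa [h2] at h3

end Crosses

/-! ### One step of the linearization -/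

/-- A map that is linear on the edges is also linear on the edges run through backwards. -/
theorem IsLinearOn.orientedEdge {L : G.Space → G.Space} (hL : ∀ e, G.IsLinearOn L e)
    (a : E × Bool) : ∃ (k : ℕ) (c : Fin k → E × Bool), 0 < k ∧
      (∀ i j : Fin k, (j : ℕ) = i + 1 → c j ≠ ((c i).1, !(c i).2)) ∧
      ∀ (i : Fin k) (s t : I), (k : ℝ) * (s : ℝ) = (i : ℕ) + (t : ℝ) →
        L (G.orientedEdge a s) = G.orientedEdge (c i) t := by
  obtain ⟨k, c, hk, hred, hc⟩ := hL a.1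
  obtain ⟨e, _ | _⟩ := a
  · refine ⟨k, fun i => ((c i.rev).1, !(c i.rev).2), hk, fun i j hij h => ?_,
      fun i s t hst => ?_⟩
    · refine hred j.rev i.rev ?_ ?_
      · simp only [Fin.val_rev]; omega
      · simp only [Prod.mk.injEq, Bool.not_not] at h
        rw [Prod.ext_iff]
        exact ⟨h.1.symm, h.2.symm⟩
    · rw [orientedEdge_not]
      refine hc i.rev (σ s) (σ t) ?_
      have : ((i.rev : ℕ) : ℝ) + i + 1 = k := by
        have : (i.rev : ℕ) + i + 1 = k := by simp only [Fin.val_rev]; omega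
        exact_mod_cast this
      simp only [unitInterval.coe_symm_eq]
      linarith
  · exact ⟨k, c, hk, hred, hc⟩

/-- `L` maps the subinterval `[s, t]` of the path `γ` affinely across the path `δ`, carrying the
point with parameter `y` to the one with parameter `x`; the map `F` crosses `δ` along `γ` as well,
on a subinterval that contains an end of `γ` only if `[s, t]` does. -/
def Tracks (F L : X → X) (γ δ : C(I, X)) (y x : I) : Prop :=
  ∃ s t : I, s < t ∧ (y : ℝ) = s + x * (t - s) ∧
    (∀ v z : I, (z : ℝ) = s + v * (t - s) → L (γ z) = δ v) ∧ Crosses F γ δ (0 < s) (t < 1)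

theorem map_iterate {Y B : Type*} {q : Y → B} {F : Y → Y} {g : B → B}
    (h : ∀ u, q (F u) = g (q u)) (n : ℕ) (u : Y) : q (F^[n] u) = g^[n] (q u) :=
  (Function.Semiconj.iterate_right (f := q) (ga := F) (gb := g) h n) u

namespace Tracks

variable {F F' L L' : X → X} {γ δ ε : C(I, X)} {x y z : I}

theorem refl (γ : C(I, X)) (y : I) : Tracks id id γ γ y y :=
  ⟨0, 1, one_pos, by simp, fun v z h => by
    have : z = v := Subtype.ext (by simpa using h)
    rw [this]; rfl, (Crosses.refl γ).mono (lt_irrefl _) (lt_irrefl _)⟩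

theorem apply_eq (h : Tracks F L γ δ y x) : L (γ y) = δ x := by
  obtain ⟨s, t, -, hy, hL, -⟩ := h
  exact hL x y hy

theorem comp (h : Tracks F L γ δ y x) (h' : Tracks F' L' δ ε x z) :
    Tracks (F' ∘ F) (L' ∘ L) γ ε y z := by
  obtain ⟨s, t, hst, hy, hL, hF⟩ := h
  obtain ⟨s', t', hst', hx, hL', hF'⟩ := h'
  have hd : (0 : ℝ) < t - s := sub_pos.2 hst
  have hd' : (0 : ℝ) < t' - s' := sub_pos.2 hst'
  -- The affine map from `[0, 1]` onto `[s, t]` stays in the unit interval.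
  have mem (v : I) : (s : ℝ) + v * (t - s) ∈ Set.Icc (0 : ℝ) 1 :=
    ⟨add_nonneg s.2.1 (mul_nonneg v.2.1 hd.le), by nlinarith [v.2.2, t.2.2]⟩
  refine ⟨⟨_, mem s'⟩, ⟨_, mem t'⟩, ?_, ?_, fun v w hw => ?_, (hF.comp hF').mono ?_ ?_⟩
  · rw [Subtype.mk_lt_mk]
    have : (s' : ℝ) < t' := hst'
    nlinarith
  · simp only [hy, hx]; ring
  · have hv : (s' : ℝ) + v * (t' - s') ∈ Set.Icc (0 : ℝ) 1 :=
      ⟨add_nonneg s'.2.1 (mul_nonneg v.2.1 hd'.le), by nlinarith [v.2.2, t'.2.2]⟩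
    rw [Function.comp_apply, hL ⟨_, hv⟩ w (by rw [hw]; simp only; ring)]
    exact hL' v _ rfl
  · intro h0
    by_contra! hcon
    have h1 : s = 0 := le_antisymm hcon.1 s.2.1
    have h2 : s' = 0 := le_antisymm hcon.2 s'.2.1
    rw [← Subtype.coe_lt_coe] at h0
    simp [h1, h2] at h0
  · intro h0
    by_contra! hcon
    have h1 : t = 1 := le_antisymm t.2.2 hcon.1
    have h2 : t' = 1 := le_antisymm t'.2.2 hcon.2
    rw [← Subtype.coe_lt_coe] at h0
    simp [h1, h2] at h0

variable [SimplyConnectedSpace X] {L : G.Space → G.Space} {ft Lt : C(X, X)}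

/-- The reduced edge path `Lt ∘ γ` and the path `ft ∘ γ` have the same end points, so the latter
has to cross every edge that the former passes. -/
theorem exists_step (hp : IsCoveringMap p) (hL : ∀ e, G.IsLinearOn L e)
    (hLt : ∀ u, p (Lt u) = L (p u)) (hv : ∀ u, p u ∈ G.vertices → ft u = Lt u)
    {a : E × Bool} (hγ : IsEdgeLift p a γ) (hy : y ∈ Set.Ioo (0 : I) 1)
    (hLy : L (p (γ y)) ∉ G.vertices) :
    ∃ b δ, IsEdgeLift p b δ ∧ ∃ x ∈ Set.Ioo (0 : I) 1, Tracks ft Lt γ δ y x := by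
  have : T2Space X := hp.t2Space
  obtain ⟨k, c, hk, hred, hc⟩ := IsLinearOn.orientedEdge hL a
  have hk0 : (0 : ℝ) < k := by exact_mod_cast hk
  -- `δ i` is the image of the `i`-th subinterval of length `1 / k`.
  let δ : ℕ → C(I, X) := fun i =>
    ⟨fun t => Lt (γ (Set.projIcc 0 1 zero_le_one ((i + (t : ℝ)) / k))), by fun_prop⟩
  have hδ : ∀ i : ℕ, ∀ s t : I, (k : ℝ) * s = i + t → δ i t = Lt (γ s) := by
    intro i s t h
    have h1 : (i + (t : ℝ)) / k = s := by rw [← h]; field_simp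
    simp only [δ, ContinuousMap.coe_mk, h1]
    congr 2
    exact Set.projIcc_val _ s
  have hparam : ∀ i < k, ∀ t : I, ∃ s : I, (k : ℝ) * s = i + t := by
    intro i hi t
    have hi' : (i : ℝ) + 1 ≤ k := by exact_mod_cast hi
    refine ⟨⟨(i + t) / k, div_nonneg (add_nonneg i.cast_nonneg t.2.1) hk0.le, ?_⟩, ?_⟩
    · rw [div_le_one hk0]; linarith [t.2.2]
    · simp only; field_simp
  have hδp : ∀ i (hi : i < k), IsEdgeLift p (c ⟨i, hi⟩) (δ i) := by
    intro i hi t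
    obtain ⟨s, hs⟩ := hparam i hi t
    rw [hδ i s t hs, hLt, hγ, hc ⟨i, hi⟩ s t hs]
  have hpath : IsReducedPath p k δ := by
    refine ⟨fun i hi => ⟨_, hδp i hi⟩, fun i hi => ?_, fun i hi h => ?_⟩
    · obtain ⟨s, hs⟩ := hparam i (by omega) 1
      rw [hδ i s 1 hs, hδ (i + 1) s 0 (by push_cast; simpa using hs)]
    · -- A parameter different from `1 / 2` tells an edge from its inverse.
      let q : I := ⟨1 / 3, by norm_num, by norm_num⟩
      have hq : q ∈ Set.Ioo (0 : I) 1 := by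
        constructor <;> rw [← Subtype.coe_lt_coe] <;> norm_num [q]
      have h1 := congrArg p (DFunLike.congr_fun h q)
      rw [hδp (i + 1) hi, (hδp i (by omega)).reverse] at h1
      rcases orientedEdge_injective_of_mem_Ioo hq h1 with h2 | h2
      · exact hred ⟨i, by omega⟩ ⟨i + 1, hi⟩ rfl h2.1.symm
      · have h3 := congrArg Subtype.val h2.2
        norm_num [q, unitInterval.coe_symm_eq] at h3
  have hstart : δ 0 0 = Lt (γ 0) := hδ 0 0 0 (by simp)
  have hend : δ (k - 1) 1 = Lt (γ 1) := hδ (k - 1) 1 1 (by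
    rw [Nat.cast_sub (by omega)]; simp)
  set i := ⌊(k : ℝ) * y⌋₊
  have hky : (0 : ℝ) ≤ k * y := mul_nonneg hk0.le y.2.1
  have hi1 : (i : ℝ) ≤ k * y := Nat.floor_le hky
  have hi2 : (k : ℝ) * y < i + 1 := Nat.lt_floor_add_one _
  have hik : i < k := by
    have : (y : ℝ) < 1 := hy.2
    have : (i : ℝ) < k := by nlinarith
    exact_mod_cast this
  have hik' : (i : ℝ) + 1 ≤ k := by exact_mod_cast hik
  let x : I := ⟨k * y - i, by linarith, by linarith⟩
  have hxy : (k : ℝ) * y = i + x := by simp [x]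
  have hx : x ∈ Set.Ioo (0 : I) 1 := by
    by_contra hx
    apply hLy
    rw [hγ, hc ⟨i, hik⟩ y x hxy]
    exact orientedEdge_mem_vertices hx
  refine ⟨_, δ i, hδp i hik, x, hx, ⟨i / k, by positivity, ?_⟩, ⟨(i + 1) / k, by positivity, ?_⟩,
    ?_, ?_, fun v z hz => ?_, ?_⟩
  · rw [div_le_one hk0]; linarith
  · rw [div_le_one hk0]; linarith
  · show (i : ℝ) / k < (i + 1) / k
    gcongr; linarith
  · simp only; field_simp; linarith
  · refine (hδ i z v ?_).symm
    rw [hz]; simp only; field_simp; ring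
  · obtain ⟨h, hh⟩ := exists_edge_coordinate hp (hδp i hik)
    have hv0 : ft (γ 0) = δ 0 0 := by
      rw [hstart]; exact hv _ (hγ.mem_vertices (by simp))
    have hv1 : ft (γ 1) = δ (k - 1) 1 := by
      rw [hend]; exact hv _ (hγ.mem_vertices (by simp))
    refine Crosses.of_coordinate ft.continuous hh ?_ ?_ (fun hs => ?_) (fun ht => ?_)
    · rw [hv0]; exact hpath.coordinate_zero hp hik hh (Nat.zero_le i)
    · rw [hv1]; exact hpath.coordinate_one hp hh (by omega) (by omega)
    · rw [hv0]
      have hi0 : 0 < i := by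
        rcases Nat.eq_zero_or_pos i with h0 | h0
        · rw [← Subtype.coe_lt_coe] at hs
          simp [h0] at hs
        · exact h0
      obtain ⟨g, hg⟩ := exists_edge_coordinate hp (hδp 0 hk)
      intro heq
      have h1 := hpath.coordinate_one hp hg (Nat.zero_le (i - 1)) (by omega)
      rw [hpath.link (i - 1) (by omega), Nat.sub_add_cancel hi0, ← heq, hg.1] at h1
      simp at h1
    · rw [hv1]
      have hi0 : i + 1 < k := by
        by_contra hcon
        have h0 : (i : ℝ) + 1 = k := by
          have : i + 1 = k := by omega
          exact_mod_cast this
        rw [← Subtype.coe_lt_coe] at ht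
        simp [h0, hk0.ne'] at ht
      obtain ⟨g, hg⟩ := exists_edge_coordinate hp (hδp (k - 1) (by omega))
      intro heq
      have h1 := hpath.coordinate_zero hp (by omega) hg (show i + 1 ≤ k - 1 by omega)
      rw [← hpath.link i hi0, ← heq, hg.1] at h1
      simp at h1

/-- Along an orbit of `L` that stays in the interiors of edges, the iterates of the two lifts cross
the same lifted edges. -/
theorem exists_iterate (hp : IsCoveringMap p) (hL : ∀ e, G.IsLinearOn L e)
    (hLt : ∀ u, p (Lt u) = L (p u)) (hv : ∀ u, p u ∈ G.vertices → ft u = Lt u)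
    (hLv : Set.MapsTo L G.vertices G.vertices)
    {a : E × Bool} (hγ : IsEdgeLift p a γ) (hy : y ∈ Set.Ioo (0 : I) 1) (n : ℕ)
    (hn : L^[n] (p (γ y)) ∉ G.vertices) :
    ∃ b δ, IsEdgeLift p b δ ∧ ∃ x ∈ Set.Ioo (0 : I) 1, Tracks ft^[n] Lt^[n] γ δ y x := by
  induction n with
  | zero => exact ⟨a, γ, hγ, y, hy, refl γ y⟩
  | succ n ih =>
    rw [Function.iterate_succ_apply'] at hn
    obtain ⟨b, δ, hδ, x, hx, h⟩ := ih fun h => hn (hLv h)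
    have hLx : L (p (δ x)) ∉ G.vertices := by
      rw [← h.apply_eq, map_iterate hLt]
      exact hn
    obtain ⟨b', δ', hδ', x', hx', h'⟩ := exists_step hp hL hLt hv hδ hx hLx
    refine ⟨b', δ', hδ', x', hx', ?_⟩
    rw [Function.iterate_succ', Function.iterate_succ']
    exact h.comp h'

end Tracks

/-! ### Covering transformations -/

/-- The image of the path `γ` under the covering transformation `g`. -/
def translate (g : deckGroup p) (γ : C(I, X)) : C(I, X) :=
  ((g : X ≃ₜ X) : C(X, X)).comp γ

@[simp] theorem translate_apply (g : deckGroup p) (γ : C(I, X)) (t : I) :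
    translate g γ t = (g : X ≃ₜ X) (γ t) := rfl

theorem reversePath_translate (g : deckGroup p) (γ : C(I, X)) :
    reversePath (translate g γ) = translate g (reversePath γ) := rfl

theorem IsEdgeLift.translate {a : E × Bool} {γ : C(I, X)} (h : IsEdgeLift p a γ)
    (g : deckGroup p) : IsEdgeLift p a (translate g γ) := fun t =>
  (g.2 (γ t)).trans (h t)

theorem deckGroup_eq_of_apply_eq [PreconnectedSpace X] (hp : IsCoveringMap p)
    {g h : deckGroup p} {u : X} (hu : (g : X ≃ₜ X) u = (h : X ≃ₜ X) u) : g = h := by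
  refine Subtype.ext (Homeomorph.ext fun x => ?_)
  exact congrFun (hp.eq_of_comp_eq (g : X ≃ₜ X).continuous (h : X ≃ₜ X).continuous
    (funext fun x => (g.2 x).trans (h.2 x).symm) u hu) x

theorem iterate_deckGroup_comm {F : X → X} (hF : ∀ g ∈ deckGroup p, ∀ u, F (g u) = g (F u))
    (n : ℕ) (g : deckGroup p) (u : X) :
    F^[n] ((g : X ≃ₜ X) u) = (g : X ≃ₜ X) (F^[n] u) :=
  (Function.Commute.iterate_left (f := F) (g := (g : X ≃ₜ X)) (hF g g.2) n) u

theorem iterate_mul_eq_pow {F : X → X} (hF : ∀ g ∈ deckGroup p, ∀ u, F (g u) = g (F u))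
    {n : ℕ} {g : deckGroup p} {u : X} (h : F^[n] u = (g : X ≃ₜ X) u) (j : ℕ) :
    F^[n * j] u = ((g ^ j : deckGroup p) : X ≃ₜ X) u := by
  induction j with
  | zero => rfl
  | succ j ih =>
    rw [Nat.mul_succ, Function.iterate_add_apply, h, iterate_deckGroup_comm hF, ih, pow_succ']
    rfl

/-! ### The two basic crossings -/

section Basic

variable {L : G.Space → G.Space} {ft Lt : C(X, X)}

/-- Around an interior periodic point of `L` whose period is `n`, the map `L^n` is affine onto the
edge. Unless it is an isometry of the whole edge, it is expanding, and so the subinterval that is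
mapped across the edge contains no end of the edge (in the orientation preserving case), or at most
one (in the orientation reversing case). -/
theorem crosses_of_interior_fixed [SimplyConnectedSpace X] (hp : IsCoveringMap p)
    (hL : ∀ e, G.IsLinearOn L e)
    (hLt : ∀ u, p (Lt u) = L (p u)) (hv : ∀ u, p u ∈ G.vertices → ft u = Lt u)
    (hLv : Set.MapsTo L G.vertices G.vertices) {a : E × Bool} {γ : C(I, X)}
    (hγ : IsEdgeLift p a γ) {y : I} (hy : y ∈ Set.Ioo (0 : I) 1) {n : ℕ} {β : deckGroup p}
    (hβ : Lt^[n] (γ y) = (β : X ≃ₜ X) (γ y)) :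
    (∀ t, Lt^[n] (γ t) = translate β γ t) ∨
      Crosses ft^[n] γ (translate β γ) True True ∨
      ((∀ t, Lt^[n] (γ t) = translate β (reversePath γ) t) ∧
        Crosses ft^[n] γ (translate β (reversePath γ)) False False) ∨
      ∃ P Q : Prop, (P ∨ Q) ∧ Crosses ft^[n] γ (translate β (reversePath γ)) P Q := by
  have hβγ := hγ.translate β
  have hn : L^[n] (p (γ y)) ∉ G.vertices := by
    rw [← map_iterate hLt, hβ]
    exact hβγ.notMem_vertices hy
  obtain ⟨b, δ, hδ, x, hx, htr⟩ := Tracks.exists_iterate hp hL hLt hv hLv hγ hy n hn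
  have hδx : translate β γ y = δ x := hβ.symm.trans htr.apply_eq
  obtain ⟨s, t, hst, hyst, haff, hcr⟩ := htr
  have hfull : s = 0 → t = 1 → ∀ z, Lt^[n] (γ z) = δ z := by
    rintro rfl rfl z
    exact haff z z (by simp)
  have hy0 : (0 : ℝ) < y := hy.1
  have hy1 : (y : ℝ) < 1 := hy.2
  rcases hβγ.eq_or_eq_reverse hp hδ hy hδx with ⟨-, rfl, rfl⟩ | ⟨-, rfl, rfl⟩
  · by_cases hs : s = 0
    · left
      refine hfull hs ?_
      subst hs
      have : (x : ℝ) * (1 - t) = 0 := by simp at hyst; linarith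
      rcases mul_eq_zero.1 this with h | h
      · exact absurd h hy0.ne'
      · exact Subtype.ext (show (t : ℝ) = 1 by linarith)
    · right; left
      have hs0 : (0 : ℝ) < s := lt_of_le_of_ne s.2.1 fun h => hs (Subtype.ext h.symm)
      refine hcr.mono (fun _ => hs0) fun _ => ?_
      refine lt_of_le_of_ne t.2.2 fun h => ?_
      simp only [h, Set.Icc.coe_one] at hyst
      nlinarith
  · right; right
    by_cases h : s = 0 ∧ t = 1
    · exact Or.inl ⟨hfull h.1 h.2, hcr.mono False.elim False.elim⟩
    · refine Or.inr ⟨_, _, ?_, hcr⟩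
      by_contra! hcon
      exact h ⟨le_antisymm hcon.1 s.2.1, le_antisymm t.2.2 hcon.2⟩

/-- If `L^m` maps the edge to a path that begins with this edge, then the lift of the path begins
with the translate of the lifted edge. -/
theorem exists_lift_beginsWith (hp : IsCoveringMap p) (hLt : ∀ u, p (Lt u) = L (p u)) {e : E}
    {γ : C(I, X)} (hγ : ∀ t, p (γ t) = G.edge e t) {m : ℕ} {α : deckGroup p}
    (hα : Lt^[m] (γ 0) = (α : X ≃ₜ X) (γ 0))
    (hbegin : G.BeginsWith (fun t => L^[m] (G.edge e t)) e) :
    ∃ (a : I) (φ : I → I), 0 < a ∧ φ 0 = 0 ∧ φ a = 1 ∧ ContinuousOn φ (Set.Icc 0 a) ∧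
      StrictMonoOn φ (Set.Icc 0 a) ∧ ∀ t ∈ Set.Icc 0 a, Lt^[m] (γ t) = translate α γ (φ t) := by
  obtain ⟨a, φ, ha, h0, h1, hcont, hmono, hφ⟩ := hbegin
  refine ⟨a, φ, ha, h0, h1, hcont, hmono, ?_⟩
  have hmem : (0 : I) ∈ Set.Icc 0 a := ⟨le_rfl, ha.le⟩
  refine hp.eqOn_of_comp_eqOn (isPreconnected_Icc (a := (0 : I)) (b := a))
    ((Lt.continuous.iterate m).comp γ.continuous).continuousOn
    ((translate α γ).continuous.comp_continuousOn hcont) (fun t ht => ?_) hmem ?_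
  · have h2 : p (translate α γ (φ t)) = G.edge e (φ t) :=
      (α.2 (γ (φ t))).trans (hγ _)
    simp only [Function.comp_apply]
    rw [map_iterate hLt, hγ, h2]
    exact hφ t ht
  · simp [hα, h0]

theorem crosses_of_beginsWith [SimplyConnectedSpace X] (hp : IsCoveringMap p)
    (hL : ∀ e, G.IsLinearOn L e)
    (hLt : ∀ u, p (Lt u) = L (p u)) (hv : ∀ u, p u ∈ G.vertices → ft u = Lt u)
    (hLv : Set.MapsTo L G.vertices G.vertices) {e : E} {γ : C(I, X)}
    (hγ : ∀ t, p (γ t) = G.edge e t) {m : ℕ} {α : deckGroup p}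
    (hα : Lt^[m] (γ 0) = (α : X ≃ₜ X) (γ 0))
    (hbegin : G.BeginsWith (fun t => L^[m] (G.edge e t)) e) :
    Crosses ft^[m] γ (translate α γ) False False := by
  obtain ⟨a, φ, ha, h0, h1, -, hmono, hφ⟩ := exists_lift_beginsWith hp hLt hγ hα hbegin
  have hφmem : ∀ z ∈ Set.Ioo 0 a, φ z ∈ Set.Ioo (0 : I) 1 := fun z hz =>
    ⟨by rw [← h0]; exact hmono ⟨le_rfl, ha.le⟩ ⟨hz.1.le, hz.2.le⟩ hz.1,
      by rw [← h1]; exact hmono ⟨hz.1.le, hz.2.le⟩ ⟨ha.le, le_rfl⟩ hz.2⟩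
  obtain ⟨y, hy⟩ := exists_between ha
  have hγ' : IsEdgeLift p (e, true) γ := hγ
  have hαγ : IsEdgeLift p (e, true) (translate α γ) := hγ'.translate α
  have hn : L^[m] (p (γ y)) ∉ G.vertices := by
    rw [← map_iterate hLt, hφ y ⟨hy.1.le, hy.2.le⟩]
    exact hαγ.notMem_vertices (hφmem y hy)
  obtain ⟨b, δ, hδ, x, hx, htr⟩ := Tracks.exists_iterate hp hL hLt hv hLv hγ'
    ⟨hy.1, hy.2.trans_le a.2.2⟩ m hn
  have hδx : translate α γ (φ y) = δ x := (hφ y ⟨hy.1.le, hy.2.le⟩).symm.trans htr.apply_eq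
  obtain ⟨s, t, hst, hyst, haff, hcr⟩ := htr
  rcases hαγ.eq_or_eq_reverse hp hδ (hφmem y hy) hδx with ⟨-, rfl, -⟩ | ⟨-, rfl, hxy⟩
  · exact hcr.mono False.elim False.elim
  · -- A crossing in the opposite direction is impossible, as `φ` is increasing at `y`.
    exfalso
    have hst' : (0 : ℝ) < t - s := sub_pos.2 hst
    have hyt : y < t := by
      rw [← Subtype.coe_lt_coe, hyst]
      have : (x : ℝ) < 1 := hx.2
      nlinarith
    obtain ⟨z, hyz, hz⟩ := exists_between (lt_min hyt hy.2)
    have hza : z ∈ Set.Ioo 0 a := ⟨hy.1.trans hyz, hz.trans_le (min_le_right _ _)⟩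
    have hzt : (z : ℝ) < t := hz.trans_le (min_le_left _ _)
    have hyz' : (y : ℝ) < z := hyz
    have hv0 : (x : ℝ) < (z - s) / (t - s) := by
      rw [lt_div_iff₀ hst']; linarith
    have hv1 : ((z : ℝ) - s) / (t - s) ≤ 1 := by
      rw [div_le_one hst']; linarith
    let v : I := ⟨(z - s) / (t - s), x.2.1.trans hv0.le, hv1⟩
    have h2 := haff v z (by simp only [v]; field_simp; ring)
    rw [hφ z ⟨hza.1.le, hza.2.le⟩] at h2
    have h3 := congrArg p h2
    rw [hαγ, reversePath_apply, hαγ] at h3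
    have h4 := (edge_injective_of_mem_Ioo (hφmem z hza) h3).2
    have h5 : φ y < φ z := hmono ⟨hy.1.le, hy.2.le⟩ ⟨hza.1.le, hza.2.le⟩ hyz
    rw [h4, unitInterval.lt_symm_comm, ← hxy] at h5
    exact absurd hv0 (not_lt.2 (le_of_lt h5))

end Basic

/-! ### Words in two covering transformations -/

/-- The number of iterations that belongs to a word: `m` for each letter `true` and `n` for each
letter `false`. -/
def wordLength (m n : ℕ) (l : List Bool) : ℕ := l.count true * m + l.count false * n

/-- The value of a word in the letters `α` (`true`) and `β` (`false`). -/
def wordValue {Γ : Type*} [Group Γ] (α β : Γ) (l : List Bool) : Γ :=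
  (l.map fun b => if b then α else β).prod

section Words

variable {F : X → X} {γ : C(I, X)} {m n : ℕ} {α β : deckGroup p}

theorem wordLength_nil (m n : ℕ) : wordLength m n [] = 0 := by simp [wordLength]

theorem wordLength_true (m n : ℕ) (l : List Bool) :
    wordLength m n (true :: l) = wordLength m n l + m := by
  simp [wordLength]; ring

theorem wordLength_false (m n : ℕ) (l : List Bool) :
    wordLength m n (false :: l) = wordLength m n l + n := by
  simp [wordLength]; ring

theorem wordValue_true {Γ : Type*} [Group Γ] (α β : Γ) (l : List Bool) :
    wordValue α β (true :: l) = α * wordValue α β l := by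
  simp [wordValue]

theorem wordValue_false {Γ : Type*} [Group Γ] (α β : Γ) (l : List Bool) :
    wordValue α β (false :: l) = β * wordValue α β l := by
  simp [wordValue]

/-- Prolonging a crossing by one that starts at a translate of its target. -/
theorem Crosses.append {γ' δ : C(I, X)} {P Q P' Q' : Prop} {k l : ℕ} {g v : deckGroup p}
    (hF : ∀ g ∈ deckGroup p, ∀ u, F (g u) = g (F u))
    (h : Crosses F^[k] γ (translate g γ') P Q) (h' : Crosses F^[l] γ' (translate v δ) P' Q') :
    Crosses F^[l + k] γ (translate (g * v) δ) (P ∨ P') (Q ∨ Q') := by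
  rw [Function.iterate_add]
  exact h.comp (h'.map_comp _ fun x => iterate_deckGroup_comm hF l g x)

theorem crosses_word (hF : ∀ g ∈ deckGroup p, ∀ u, F (g u) = g (F u))
    (hα : Crosses F^[m] γ (translate α γ) False False)
    (hβ : Crosses F^[n] γ (translate β γ) True True) (l : List Bool) :
    Crosses F^[wordLength m n l] γ (translate (wordValue α β l) γ) (false ∈ l) (false ∈ l) := by
  induction l with
  | nil =>
    rw [wordLength_nil]
    exact (Crosses.refl γ).mono (fun h => by simp at h) fun h => by simp at h
  | cons b l ih =>
    rcases b with _ | _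
    · rw [wordLength_false, wordValue_false]
      exact (hβ.append hF ih).mono (by simp) (by simp)
    · rw [wordLength_true, wordValue_true]
      exact (hα.append hF ih).mono (by simp) (by simp)

/-- The crossings that belong to a word when `β` reverses the edge: the parity of the number of
letters `β` decides on the orientation. With two letters `β`, both ends are avoided if one of them
is avoided by the crossing that belongs to `β`. -/
theorem crosses_word_of_reverse {P Q : Prop} (hPQ : P ∨ Q)
    (hF : ∀ g ∈ deckGroup p, ∀ u, F (g u) = g (F u))
    (hα : Crosses F^[m] γ (translate α γ) False False)
    (hβ : Crosses F^[n] γ (translate β (reversePath γ)) P Q) (l : List Bool) :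
    (l.count false = 0 → Crosses F^[wordLength m n l] γ (translate (wordValue α β l) γ)
      False False) ∧
    (Odd (l.count false) → Crosses F^[wordLength m n l] γ
      (translate (wordValue α β l) (reversePath γ)) P Q) ∧
    (Even (l.count false) → 0 < l.count false →
      Crosses F^[wordLength m n l] γ (translate (wordValue α β l) γ) True True) := by
  induction l with
  | nil => exact ⟨fun _ => by rw [wordLength_nil]; exact Crosses.refl γ, by simp, by simp⟩
  | cons b l ih =>
    obtain ⟨ih0, ih1, ih2⟩ := ih
    rcases b with _ | _
    · rw [wordLength_false, wordValue_false, List.count_cons_self]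
      refine ⟨by simp, fun hodd => ?_, fun heven _ => ?_⟩
      · have he : Even (l.count false) := by
          by_contra h
          exact (Nat.not_even_iff_odd.2 hodd) ((Nat.not_even_iff_odd.1 h).add_one)
        rcases Nat.eq_zero_or_pos (l.count false) with h0 | h0
        · have h := (ih0 h0).reverse
          rw [reversePath_translate] at h
          exact (hβ.append hF h).mono Or.inl Or.inl
        · have h := (ih2 he h0).reverse
          rw [reversePath_translate] at h
          exact (hβ.append hF h).mono Or.inl Or.inl
      · have ho : Odd (l.count false) := by
          by_contra h
          exact (Nat.not_even_iff_odd.2 (Nat.not_odd_iff_even.1 h).add_one) heven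
        have h := (ih1 ho).reverse
        rw [reversePath_translate, reversePath_reversePath] at h
        exact (hβ.append hF h).mono (fun _ => hPQ) fun _ => hPQ.symm
    · rw [wordLength_true, wordValue_true, List.count_cons_of_ne (by simp)]
      exact ⟨fun h => (hα.append hF (ih0 h)).mono False.elim False.elim,
        fun h => (hα.append hF (ih1 h)).mono Or.inr Or.inr,
        fun h h' => (hα.append hF (ih2 h h')).mono Or.inr Or.inr⟩

theorem iterate_wordLength_eq (hF : ∀ g ∈ deckGroup p, ∀ u, F (g u) = g (F u)) {u : X}
    (hα : F^[m] u = (α : X ≃ₜ X) u) {l : List Bool}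
    (hβ : false ∈ l → F^[n] u = (β : X ≃ₜ X) u) :
    F^[wordLength m n l] u = ((wordValue α β l : deckGroup p) : X ≃ₜ X) u := by
  induction l with
  | nil => simp [wordLength, wordValue]
  | cons b l ih =>
    have ih := ih fun h => hβ (List.mem_cons_of_mem _ h)
    rcases b with _ | _
    · rw [wordLength_false, wordValue_false, Function.iterate_add_apply, hβ (by simp),
        iterate_deckGroup_comm hF, ih]
      rfl
    · rw [wordLength_true, wordValue_true, Function.iterate_add_apply, hα,
        iterate_deckGroup_comm hF, ih]
      rfl

theorem iterate_wordLength_eq_of_swap (hF : ∀ g ∈ deckGroup p, ∀ u, F (g u) = g (F u))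
    {u : I → X} (hα : ∀ t, t ∉ Set.Ioo (0 : I) 1 → F^[m] (u t) = (α : X ≃ₜ X) (u t))
    (hβ : ∀ t, t ∉ Set.Ioo (0 : I) 1 → F^[n] (u t) = (β : X ≃ₜ X) (u (σ t))) (l : List Bool) :
    ∀ t, t ∉ Set.Ioo (0 : I) 1 → F^[wordLength m n l] (u t) =
      ((wordValue α β l : deckGroup p) : X ≃ₜ X) (u (σ^[l.count false] t)) := by
  induction l with
  | nil => simp [wordLength, wordValue]
  | cons b l ih =>
    intro t ht
    rcases b with _ | _
    · rw [wordLength_false, wordValue_false, Function.iterate_add_apply, hβ t ht,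
        iterate_deckGroup_comm hF, ih _ (mt symm_mem_Ioo.1 ht), List.count_cons_self,
        Function.iterate_succ_apply]
      rfl
    · rw [wordLength_true, wordValue_true, Function.iterate_add_apply, hα t ht,
        iterate_deckGroup_comm hF, ih _ ht, List.count_cons_of_ne (by simp)]
      rfl

end Words

theorem formalRoot_pow {Γ : Type*} [Group Γ] (w : Γ) (n j : ℕ+) :
    formalRoot w n = formalRoot (w ^ (j : ℕ)) (j * n) :=
  Quot.sound ⟨j, rfl⟩

/-- If every letter acts on the two ends of the edge, `α` fixing and `β` exchanging them, then all
words have the same formal root. -/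
theorem formalRoot_wordValue_eq_of_swap [PreconnectedSpace X] (hp : IsCoveringMap p) {F : X → X}
    (hF : ∀ g ∈ deckGroup p, ∀ u, F (g u) = g (F u)) {γ : C(I, X)} {m n : ℕ+}
    {α β : deckGroup p}
    (hα : ∀ t, t ∉ Set.Ioo (0 : I) 1 → F^[m] (γ t) = (α : X ≃ₜ X) (γ t))
    (hβ : ∀ t, t ∉ Set.Ioo (0 : I) 1 → F^[n] (γ t) = (β : X ≃ₜ X) (γ (σ t)))
    (l : List Bool) {k : ℕ+} (hk : (k : ℕ) = wordLength m n l) :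
    formalRoot (wordValue α β l) k = formalRoot β n := by
  have h0 : (0 : I) ∉ Set.Ioo (0 : I) 1 := by simp
  -- The square of a word maps the initial vertex to a translate of itself.
  have sq : ∀ l : List Bool, F^[wordLength m n l * 2] (γ 0) =
      ((wordValue α β l ^ 2 : deckGroup p) : X ≃ₜ X) (γ 0) := by
    intro l
    have h := iterate_wordLength_eq_of_swap hF hα hβ (l ++ l) 0 h0
    have h1 : wordLength m n (l ++ l) = wordLength m n l * 2 := by
      simp [wordLength]; ring
    have h2 : wordValue α β (l ++ l) = wordValue α β l ^ 2 := by
      simp [wordValue, sq]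
    have h3 : (l ++ l).count false = 2 * l.count false := by
      simp; ring
    rwa [h1, h2, h3, Function.iterate_mul σ, show σ^[2] = id from funext fun t => by simp,
      Function.iterate_id] at h
  have hβ2 := sq [false]
  have e1 : wordLength (m : ℕ) n [false] = n := by simp [wordLength]
  have e2 : wordValue α β [false] = β := by simp [wordValue]
  rw [e1, e2] at hβ2
  have hl2 := sq l
  rw [← hk] at hl2
  have key : (wordValue α β l ^ 2) ^ (n : ℕ) = (β ^ 2) ^ (k : ℕ) := by
    refine deckGroup_eq_of_apply_eq hp (u := γ 0) ?_
    rw [← iterate_mul_eq_pow hF hl2, ← iterate_mul_eq_pow hF hβ2,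
      show (k : ℕ) * 2 * n = n * 2 * k by ring]
  rw [formalRoot_pow (wordValue α β l) k (2 * n), formalRoot_pow β n (2 * k)]
  have h1 : wordValue α β l ^ ((2 * n : ℕ+) : ℕ) = β ^ ((2 * k : ℕ+) : ℕ) := by
    rw [PNat.mul_coe, PNat.mul_coe, pow_mul, pow_mul]
    exact key
  rw [h1]
  congr 1
  ring

/-! ### Rotation elements -/

theorem IsLinearization.eq_on_vertices {f L : C(G.Space, G.Space)} (h : G.IsLinearization f L)
    {x : G.Space} (hx : x ∈ G.vertices) : f x = L x := by
  obtain ⟨H⟩ := h.1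
  exact H.fst_eq_snd hx

theorem IsInducedLift.map_eq {f L : C(G.Space, G.Space)} {ft Lt : C(X, X)}
    (h : G.IsInducedLift p f L ft Lt) (u : X) : p (Lt u) = L (p u) := by
  obtain ⟨H, K, hK⟩ := h
  simpa using hK 1 u

/-- The homotopy is constant at a vertex, so its lift is constant over the vertices. -/
theorem IsInducedLift.eq_of_mem_vertices (hp : IsCoveringMap p) {f L : C(G.Space, G.Space)}
    {ft Lt : C(X, X)} (h : G.IsInducedLift p f L ft Lt) {u : X} (hu : p u ∈ G.vertices) :
    ft u = Lt u := by
  obtain ⟨H, K, hK⟩ := h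
  have h1 := hp.const_of_comp (g := fun s : I => K (s, u)) (by fun_prop) (fun s t => by
    rw [hK, hK, H.eq_fst s hu, H.eq_fst t hu]) 0 1
  simpa using h1

/-- If `L^n` exchanges the ends of the edge, then `L^m` fixes both ends: the initial segment of the
edge that `L^m` maps onto the edge is the whole edge, since its end point is mapped to a vertex by
`L^m` and to itself by `L^(2nm)`. -/
theorem iterate_apply_one_of_swap (hp : IsCoveringMap p) {L : G.Space → G.Space} {Lt : C(X, X)}
    (hLt : ∀ u, p (Lt u) = L (p u)) (hLv : Set.MapsTo L G.vertices G.vertices) {e : E}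
    {γ : C(I, X)} (hγ : ∀ t, p (γ t) = G.edge e t) {m n : ℕ+} {α β : deckGroup p}
    (hα : Lt^[m] (γ 0) = (α : X ≃ₜ X) (γ 0))
    (hbegin : G.BeginsWith (fun t => L^[m] (G.edge e t)) e)
    (hβ : ∀ t, Lt^[n] (γ t) = translate β (reversePath γ) t) :
    Lt^[m] (γ 1) = (α : X ≃ₜ X) (γ 1) := by
  obtain ⟨a, φ, ha, -, h1, -, -, hφ⟩ := exists_lift_beginsWith hp hLt hγ hα hbegin
  have hflip : ∀ t, L^[n] (G.edge e t) = G.edge e (σ t) := by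
    intro t
    rw [← hγ, ← map_iterate hLt, hβ, ← hγ]
    exact β.2 _
  have hperiod : Function.IsPeriodicPt L (n + n : ℕ) (G.edge e a) := by
    show L^[(n + n : ℕ)] (G.edge e a) = G.edge e a
    rw [Function.iterate_add_apply, hflip, hflip, unitInterval.symm_symm]
  have hvert : L^[m] (G.edge e a) ∈ G.vertices := by
    rw [← hγ, ← map_iterate hLt, hφ a ⟨ha.le, le_rfl⟩, h1,
      show p (translate α γ 1) = p (γ 1) from α.2 _, hγ]
    exact edge_mem_vertices (by simp)
  have ha1 : a = 1 := by
    by_contra hne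
    refine edge_notMem_vertices (G := G) (e := e) ⟨ha, unitInterval.lt_one_iff_ne_one.2 hne⟩ ?_
    have h2 : L^[(n + n : ℕ) * m] (G.edge e a) = G.edge e a := hperiod.mul_const m
    rw [← h2]
    obtain ⟨c, hc⟩ : ∃ c, (n + n : ℕ) * m = c + m :=
      ⟨(n + n - 1 : ℕ) * m, by
        have : (n + n : ℕ) = (n + n - 1 : ℕ) + 1 := by have := n.pos; omega
        conv_lhs => rw [this]
        ring⟩
    rw [hc, Function.iterate_add_apply]
    exact hLv.iterate c hvert
  have h2 := hφ a ⟨ha.le, le_rfl⟩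
  rw [h1, ha1] at h2
  exact h2

/-- A point of the lifted edge that an iterate of the lift maps to a translate of itself lies over
a periodic point with the corresponding rotation element. -/
theorem exists_rotationElement {f : G.Space → G.Space} {F : X → X} {γ : C(I, X)} {e : E}
    (hF : ∀ u, p (F u) = f (p u)) (hγ : ∀ t, p (γ t) = G.edge e t) {k : ℕ+} {v : deckGroup p}
    (h : ∃ z ∈ Set.Ioo (0 : I) 1, F^[k] (γ z) = ((v : X ≃ₜ X) : C(X, X)) (γ z)) :
    ∃ z ∈ Set.Ioo (0 : I) 1, G.edge e z ∈ Function.periodicPts f ∧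
      IsRotationElement p F (γ z) (formalRoot v k) := by
  obtain ⟨z, hz, h⟩ := h
  refine ⟨z, hz, ⟨k, k.pos, ?_⟩, k, v, h, rfl⟩
  show f^[k] (G.edge e z) = G.edge e z
  rw [← hγ, ← map_iterate hF, h]
  exact v.2 _

end MultiDigraph

open MultiDigraph in
theorem mainTheorem8
    {V E X : Type*} [Finite V] [Finite E] (G : MultiDigraph V E)
    (hloop : ∀ e : E, G.src e ≠ G.tgt e) (hconn : ConnectedSpace G.Space)
    -- the universal covering
    [TopologicalSpace X] [SimplyConnectedSpace X] (p : X → G.Space) (hp : IsCoveringMap p)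
    -- the vertex map, homotopic to the identity, and its linearization
    (f L : C(G.Space, G.Space)) (hf : G.IsVertexMap f)
    (hid : f.Homotopic (ContinuousMap.id G.Space)) (hL : G.IsLinearization f L)
    -- the lift of `f`, commuting with the covering transformations, and the one of `L`
    (ft Lt : C(X, X)) (hft : ∀ u, p (ft u) = f (p u))
    (hcomm : ∀ g ∈ deckGroup p, ∀ u, ft (g u) = g (ft u))
    (hLt : G.IsInducedLift p f L ft Lt)
    -- the edge and its chosen lift
    (e : E) (et : C(I, X)) (het : ∀ t, p (et t) = G.edge e t)
    -- the initial vertex of the edge, with rotation element `α^(1/m)`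
    (m : ℕ+) (hx : f^[m] (G.edge e 0) = G.edge e 0)
    (α : deckGroup p) (hα : ft^[m] (et 0) = (α : X ≃ₜ X) (et 0))
    -- an interior point of the edge, with rotation element `β^(1/n)`
    (n : ℕ+) (y : I) (hy : y ∈ Set.Ioo 0 1) (hyfix : L^[n] (G.edge e y) = G.edge e y)
    (β : deckGroup p) (hβ : Lt^[n] (et y) = (β : X ≃ₜ X) (et y))
    (hbegin : G.BeginsWith (fun t => L^[m] (G.edge e t)) e) :
    (∀ q ∈ rootSet α m β n, IsRotationElement p ft (et 0) q ∨
      ∃ z ∈ Set.Ioo (0 : I) 1, G.edge e z ∈ Function.periodicPts f ∧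
        IsRotationElement p ft (et z) q) ∧
    ((∃ t : I, L^[n] (G.edge e t) ≠ G.edge e t) →
      ∀ q ∈ rootSetPos α m β n,
        ∃ z ∈ Set.Ioo (0 : I) 1, G.edge e z ∈ Function.periodicPts f ∧
          IsRotationElement p ft (et z) q) := by
  have hLt' := hLt.map_eq
  have hv : ∀ u, p u ∈ G.vertices → ft u = Lt u := fun u hu => hLt.eq_of_mem_vertices hp hu
  have hLv : Set.MapsTo L G.vertices G.vertices := fun x hx => by
    rw [← hL.eq_on_vertices hx]; exact hf.mapsTo hx
  -- The iterates of the two lifts agree over the vertices.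
  have hvit : ∀ (j : ℕ) (t : I), t ∉ Set.Ioo (0 : I) 1 → ft^[j] (et t) = Lt^[j] (et t) := by
    intro j t ht
    have hmem : ∀ i, p (Lt^[i] (et t)) ∈ G.vertices := fun i => by
      rw [map_iterate hLt', het]
      exact hLv.iterate i (edge_mem_vertices ht)
    induction j with
    | zero => rfl
    | succ j ih =>
      rw [Function.iterate_succ_apply', Function.iterate_succ_apply', ih, hv _ (hmem j)]
  have h0 : (0 : I) ∉ Set.Ioo (0 : I) 1 := by simp
  have hαL : Lt^[m] (et 0) = (α : X ≃ₜ X) (et 0) := (hvit m 0 h0).symm.trans hα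
  have hA := crosses_of_beginsWith hp hL.2 hLt' hv hLv het hαL hbegin
  have hword : ∀ (l : List Bool) (k : ℕ+), (k : ℕ) = wordLength m n l →
      (false ∈ l → ft^[n] (et 0) = (β : X ≃ₜ X) (et 0)) →
      IsRotationElement p ft (et 0) (formalRoot (wordValue α β l) k) := by
    intro l k hk h
    refine ⟨k, _, ?_, rfl⟩
    rw [hk]
    exact iterate_wordLength_eq hcomm hα h
  have main : (∀ t, Lt^[n] (et t) = translate β et t) ∨
      ∀ q ∈ rootSetPos α m β n, ∃ z ∈ Set.Ioo (0 : I) 1,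
        G.edge e z ∈ Function.periodicPts f ∧ IsRotationElement p ft (et z) q := by
    rcases crosses_of_interior_fixed hp hL.2 hLt' hv hLv (a := (e, true)) het hy hβ with
      h | h | ⟨h, hB⟩ | ⟨P, Q, hPQ, hB⟩
    · exact Or.inl h
    all_goals
      right
      rintro q ⟨l, hl, k, hk, rfl⟩
      change (k : ℕ) = wordLength m n l at hk
      change ∃ z ∈ Set.Ioo (0 : I) 1, G.edge e z ∈ Function.periodicPts f ∧
        IsRotationElement p ft (et z) (formalRoot (wordValue α β l) k)
    · refine exists_rotationElement hft het ?_
      rw [hk]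
      exact ((crosses_word hcomm hA h l).mono (fun _ => hl) fun _ => hl).exists_mem_Ioo_eq
    · -- Here all words have the same formal root as `β`, for which the crossing reverses the edge.
      have hα1 := iterate_apply_one_of_swap hp hLt' hLv het hαL hbegin h
      rw [formalRoot_wordValue_eq_of_swap hp hcomm (γ := et) (m := m) (n := n) (α := α) (β := β)
        (fun t ht => ?_) (fun t ht => (hvit n t ht).trans (h t)) l hk]
      · exact exists_rotationElement hft het hB.exists_mem_Ioo_eq_of_reverse
      · rw [hvit m t ht]
        rcases eq_or_ne t 0 with rfl | ht0
        · exact hαL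
        rcases eq_or_ne t 1 with rfl | ht1
        · exact hα1
        exact absurd ⟨unitInterval.pos_iff_ne_zero.2 ht0,
          unitInterval.lt_one_iff_ne_one.2 ht1⟩ ht
    · refine exists_rotationElement hft het ?_
      rw [hk]
      obtain ⟨-, hodd, heven⟩ := crosses_word_of_reverse hPQ hcomm hA hB l
      rcases Nat.even_or_odd (l.count false) with hc | hc
      · exact (heven hc (List.count_pos_iff.2 hl)).exists_mem_Ioo_eq
      · exact (hodd hc).exists_mem_Ioo_eq_of_reverse
  constructor
  · rintro q ⟨l, -, k, hk, rfl⟩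
    by_cases hl : false ∈ l
    · rcases main with h | h
      · exact Or.inl (hword l k hk fun _ => (hvit n 0 h0).trans (h 0))
      · exact Or.inr (h _ ⟨l, hl, k, hk, rfl⟩)
    · exact Or.inl (hword l k hk fun h => absurd h hl)
  · rintro ⟨t, ht⟩
    refine main.resolve_left fun h => ht ?_
    rw [← het, ← map_iterate hLt', h]
    exact β.2 _
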